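/- **Setting.** A seller offers one item during $[0,T]$, $T>0$. Agents arrive according to a Poisson process of rate $\lambda>0$; let $W_i$ be the arrival time of the $i$-th agent. The agents' initial valuations $V_i$ are i.i.d. with law $F$ on $[1,h]$, $h>1$, independent of the arrivals. The discount function $\xi:[0,T]\to[0,1]$ is continuous and non-increasing with $\xi(0)=1$, $\xi(T)=0$; put $\xi(t)=0$ for $t>T$. Under a posted-price mechanism with pricing strategy $p:[0,T]\to\mathbb R_{\ge 0}$, the item is sold to the first agent $i$ with $W_i\le T$ and $V_i\,\xi(W_i)\ge p(W_i)$, at price $p(W_i)$. Let $\mathbb E_F[\mathcal R(p)]$ be the expected revenue, and let the benchmark $\mathbb E_F[\mathcal R(\mathcal M^\star)]$ be the supremum of $\mathbb E_F[\mathcal R(p)]$ over all pricing strategies $p$ (these may depend on $F$). Let $\mathcal F$ be the set of laws $F$ on $[1,h]$ that have a density $f$ with hazard rate $f/(1-F)$ non-decreasing where $F<1$. The competitive ratio of $p$ is $\rho(p)=\inf_{F\in\mathcal F}\mathbb E_F[\mathcal R(p)]/\mathbb E_F[\mathcal R(\mathcal M^\star)]$. **The mechanism $\mathcal M_C$.**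 Let $t_0\in[0,T)$ be the unique time such that $$\int_{t_0}^{T}\xi(s)\,\lambda e^{-\lambda(s-t_0)}\,ds \;=\; k, \qquad k:=\frac{\lambda\int_0^{t_0}\xi(s)\,ds}{\lambda t_0+\ln h}.$$ The pricing strategy of $\mathcal M_C$ is $p_C(t)=h\,\xi(t)\exp\!\big(\lambda t-\tfrac{\lambda}{k}\int_0^t\xi(s)\,ds\big)$ for $t<t_0$ and $p_C(t)=\xi(t)$ for $t\ge t_0$. For $0<\tau\le T$ and $0\le b\le T-\tau$ let $$\kappa_\tau:=\sup_{s\in[0,T-\tau]}\frac{p_C(s)}{p_C(s+\tau)},\qquad \kappa_\tau^{b}:=\sup_{s\in[0,b]}\frac{p_C(s)}{p_C(s+\tau)}\qquad\text{in }[0,\infty],$$ with $x/0=\infty$ for $x>0$, $0/0=0$ and $x/\infty=0$ for $x<\infty$. **Theorem.** Assume $\lambda\tau=(\lambda T)^{1-\varepsilon}\ge 1-\ln(e-1)$ for some $\tau\in(0,T]$ and $\varepsilon\in(0,1)$. Then $$\rho(\mathcal M_C)\;\ge\;\frac{\xi\big(t_0+T^{1-\varepsilon}\lambda^{-\varepsilon}\big)(1-\varepsilon)}{\kappa_\tau\,e}.$$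 Moreover, the same bound holds with $\kappa_\tau$ replaced by the smaller number $\kappa_\tau^{b}$, $b=\min\{t_0,T-\tau\}$, that is, by the maximal price ratio over the intervals of length $\tau$ that start at or before $t_0$. -/

import Mathlib

open MeasureTheory ProbabilityTheory Set
open scoped ENNReal

noncomputable section

namespace PostedPrice

/-- The data of the selling problem: Poisson arrival rate `lam`, length `T` of the selling period,
range `[1, h]` of the (normalized) initial valuations, and discount function `xi` on `[0, T]`,
which is continued by `0` after the deadline `T`. -/
structure Market where
  lam : ℝ
  T : ℝ
  h : ℝ
  xi : ℝ → ℝ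
  lam_pos : 0 < lam
  T_pos : 0 < T
  one_lt_h : 1 < h
  xi_continuousOn : ContinuousOn xi (Icc 0 T)
  xi_antitoneOn : AntitoneOn xi (Icc 0 T)
  xi_zero : xi 0 = 1
  xi_eq_zero : ∀ t, T ≤ t → xi t = 0

namespace Market

variable (M : Market)

/-! ### The stochastic model

A sample point `ω : ℕ → ℝ × ℝ` lists, in order of arrival, the waiting time between the agent and
her predecessor and the agent's initial valuation. -/

instance isProbabilityMeasure_gap : IsProbabilityMeasure (expMeasure M.lam) :=
  isProbabilityMeasure_expMeasure M.lam_pos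

/-- The law of arrivals and valuations: the waiting times are i.i.d. exponential with rate `lam`
(so that the arrivals form a Poisson process of rate `lam`), the initial valuations are i.i.d.
with law `F`, and the two sequences are independent. -/
def agentsLaw (F : ProbabilityMeasure ℝ) : Measure (ℕ → ℝ × ℝ) :=
  Measure.infinitePi fun _ : ℕ => (expMeasure M.lam).prod (F : Measure ℝ)

/-- The arrival time of agent `i` (agents are numbered from `0`). -/
def arrivalTime (ω : ℕ → ℝ × ℝ) (i : ℕ) : ℝ := ∑ j ∈ Finset.range (i + 1), (ω j).1

/-- The initial valuation of agent `i`. -/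
def valuation (ω : ℕ → ℝ × ℝ) (i : ℕ) : ℝ := (ω i).2

/-- Agent `i` arrives in the selling period and her discounted valuation is at least the price
posted at her arrival. -/
def Accepts (p : ℝ → ℝ) (ω : ℕ → ℝ × ℝ) (i : ℕ) : Prop :=
  arrivalTime ω i ≤ M.T ∧
    p (arrivalTime ω i) ≤ valuation ω i * M.xi (arrivalTime ω i)

open Classical in
/-- The revenue of the seller: the single item goes to the first accepting agent, who pays the price
posted at her arrival; the revenue is `0` if no agent accepts. -/
def revenue (p : ℝ → ℝ) (ω : ℕ → ℝ × ℝ) : ℝ≥0∞ :=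
  if hex : ∃ i, M.Accepts p ω i then ENNReal.ofReal (p (arrivalTime ω (Nat.find hex))) else 0

/-- The expected revenue of the posted-price mechanism with pricing strategy `p` when the valuations
have law `F`. -/
def expectedRevenue (F : ProbabilityMeasure ℝ) (p : ℝ → ℝ) : ℝ≥0∞ :=
  ∫⁻ ω, M.revenue p ω ∂(M.agentsLaw F)

/-- Pricing strategies of deterministic posted-price mechanisms. -/
def IsPricing (p : ℝ → ℝ) : Prop := Measurable p ∧ ∀ t ∈ Icc 0 M.T, 0 ≤ p t

/-- The expected revenue of the benchmark, an optimal mechanism that knows the law `F`. -/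
def benchmark (F : ProbabilityMeasure ℝ) : ℝ≥0∞ :=
  ⨆ (p : ℝ → ℝ) (_ : M.IsPricing p), M.expectedRevenue F p

/-- The competitive ratio of a pricing strategy over a family of laws of the valuations. -/
def competitiveRatio (laws : Set (ProbabilityMeasure ℝ)) (p : ℝ → ℝ) : ℝ≥0∞ :=
  ⨅ F ∈ laws, M.expectedRevenue F p / M.benchmark F

/-- `F` has a density `f` whose hazard rate `f / (1 - F)` is non-decreasing. -/
def IsMHR (F : ProbabilityMeasure ℝ) : Prop :=
  ∃ f : ℝ → ℝ, Measurable f ∧ (∀ x, 0 ≤ f x) ∧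
    (F : Measure ℝ) = volume.withDensity (fun x => ENNReal.ofReal (f x)) ∧
    MonotoneOn (fun x => f x / (1 - cdf (F : Measure ℝ) x))
      {x | cdf (F : Measure ℝ) x < 1}

/-- The laws on `[1, h]` with monotone hazard rate. -/
def mhrLaws : Set (ProbabilityMeasure ℝ) :=
  {F | (F : Measure ℝ) (Icc 1 M.h) = 1 ∧ IsMHR F}

/-! ### The mechanism `M_C` -/

/-- Given that nothing is sold before time `t`, the expected revenue from posting the minimum price
`xi` on `[t, T]`: every arriving agent buys, so only the first arrival after `t` matters. -/
def tailRevenue (t : ℝ) : ℝ :=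
  ∫ s in t..M.T, M.xi s * (M.lam * Real.exp (-(M.lam * (s - t))))

/-- For the price `h * xi t * exp (lam * t - (lam / k) * ∫ s in 0..t, xi s)` to reach `xi` at
time `t₀`, the constant `k` has to be this. -/
def slopeConst (t₀ : ℝ) : ℝ :=
  (M.lam * ∫ s in (0 : ℝ)..t₀, M.xi s) / (M.lam * t₀ + Real.log M.h)

/-- The condition which determines the time from which the minimum price is posted. -/
def IsSwitchTime (t₀ : ℝ) : Prop :=
  t₀ ∈ Ico 0 M.T ∧ M.tailRevenue t₀ = M.slopeConst t₀

/-- A continuous function on the line which agrees with `xi` on `[0, T]`. -/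
def xiExt (t : ℝ) : ℝ := M.xi (max 0 (min t M.T))

lemma clamp_mem (t : ℝ) : max 0 (min t M.T) ∈ Icc 0 M.T :=
  ⟨le_max_left _ _, max_le M.T_pos.le (min_le_right _ _)⟩

lemma xiExt_eq {t : ℝ} (ht : t ∈ Icc 0 M.T) : M.xiExt t = M.xi t := by
  unfold xiExt
  rw [min_eq_left ht.2, max_eq_right ht.1]

lemma continuous_xiExt : Continuous M.xiExt := by
  have h1 : Continuous fun t : ℝ => max 0 (min t M.T) := by fun_prop
  exact M.xi_continuousOn.comp_continuous h1 M.clamp_mem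

lemma antitone_xiExt : Antitone M.xiExt := fun a b hab =>
  M.xi_antitoneOn (M.clamp_mem a) (M.clamp_mem b)
    (max_le_max le_rfl (min_le_min hab le_rfl))

lemma xiExt_nonneg (t : ℝ) : 0 ≤ M.xiExt t := by
  have h1 := M.xi_antitoneOn (M.clamp_mem t) ⟨M.T_pos.le, le_rfl⟩ (M.clamp_mem t).2
  rw [M.xi_eq_zero M.T le_rfl] at h1
  exact h1

lemma xiExt_zero : M.xiExt 0 = 1 := by
  rw [M.xiExt_eq ⟨le_rfl, M.T_pos.le⟩, M.xi_zero]

lemma tailRevenue_eq {t : ℝ} (ht : t ∈ Icc 0 M.T) :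
    M.tailRevenue t =
      Real.exp (M.lam * t) * ∫ s in t..M.T, M.xiExt s * (M.lam * Real.exp (-(M.lam * s))) := by
  unfold tailRevenue
  rw [← intervalIntegral.integral_const_mul]
  refine intervalIntegral.integral_congr fun s hs => ?_
  rw [uIcc_of_le ht.2] at hs
  have h2 : Real.exp (-(M.lam * (s - t))) = Real.exp (M.lam * t) * Real.exp (-(M.lam * s)) := by
    rw [← Real.exp_add]; congr 1; ring
  simp only [M.xiExt_eq ⟨ht.1.trans hs.1, hs.2⟩, h2]
  ring

lemma integral_xi_eq {t : ℝ} (ht : t ∈ Icc 0 M.T) :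
    ∫ s in (0 : ℝ)..t, M.xi s = ∫ s in (0 : ℝ)..t, M.xiExt s := by
  refine intervalIntegral.integral_congr fun s hs => ?_
  rw [uIcc_of_le ht.1] at hs
  exact (M.xiExt_eq ⟨hs.1, hs.2.trans ht.2⟩).symm

lemma log_h_pos : 0 < Real.log M.h := Real.log_pos M.one_lt_h

lemma integral_xiExt_pos {t : ℝ} (ht : 0 < t) : 0 < ∫ s in (0 : ℝ)..t, M.xiExt s := by
  refine intervalIntegral.integral_pos ht M.continuous_xiExt.continuousOn
    (fun s _ => M.xiExt_nonneg s) ⟨0, ⟨le_rfl, ht.le⟩, ?_⟩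
  rw [M.xiExt_zero]; exact one_pos

/-- The switch time is the zero of this function. -/
def switchFun (t : ℝ) : ℝ :=
  M.lam * (∫ s in (0 : ℝ)..t, M.xiExt s) -
    (Real.exp (M.lam * t) * ∫ s in t..M.T, M.xiExt s * (M.lam * Real.exp (-(M.lam * s)))) *
      (M.lam * t + Real.log M.h)

lemma isSwitchTime_iff (t : ℝ) : M.IsSwitchTime t ↔ t ∈ Ico 0 M.T ∧ M.switchFun t = 0 := by
  refine and_congr_right fun ht => ?_
  have ht' : t ∈ Icc 0 M.T := ⟨ht.1, ht.2.le⟩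
  have hpos : 0 < M.lam * t + Real.log M.h :=
    add_pos_of_nonneg_of_pos (mul_nonneg M.lam_pos.le ht.1) M.log_h_pos
  rw [M.tailRevenue_eq ht', slopeConst, M.integral_xi_eq ht', eq_div_iff hpos.ne', switchFun,
    sub_eq_zero]
  exact eq_comm

lemma hasDerivAt_switchFun (t : ℝ) :
    HasDerivAt M.switchFun
      ((M.lam * M.xiExt t - M.lam * (Real.exp (M.lam * t) *
        ∫ s in t..M.T, M.xiExt s * (M.lam * Real.exp (-(M.lam * s))))) *
          (1 + (M.lam * t + Real.log M.h))) t := by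
  have hc : Continuous fun s : ℝ => M.xiExt s * (M.lam * Real.exp (-(M.lam * s))) := by
    have := M.continuous_xiExt
    fun_prop
  have h1 : HasDerivAt (fun u => ∫ s in (0 : ℝ)..u, M.xiExt s) (M.xiExt t) t :=
    intervalIntegral.integral_hasDerivAt_right (M.continuous_xiExt.intervalIntegrable _ _)
      M.continuous_xiExt.aestronglyMeasurable.stronglyMeasurableAtFilter
      M.continuous_xiExt.continuousAt
  have h2 := intervalIntegral.integral_hasDerivAt_left (hc.intervalIntegrable t M.T)
      hc.aestronglyMeasurable.stronglyMeasurableAtFilter hc.continuousAt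
  have h3 : HasDerivAt (fun u : ℝ => Real.exp (M.lam * u)) (Real.exp (M.lam * t) * M.lam) t := by
    simpa using ((hasDerivAt_id t).const_mul M.lam).exp
  have h4 : HasDerivAt (fun u : ℝ => M.lam * u + Real.log M.h) M.lam t := by
    simpa using ((hasDerivAt_id t).const_mul M.lam).add_const (Real.log M.h)
  have h5 : Real.exp (M.lam * t) * Real.exp (-(M.lam * t)) = 1 := by
    rw [← Real.exp_add]; simp
  refine ((h1.const_mul M.lam).sub ((h3.mul h2).mul h4)).congr_deriv ?_
  simp only [Pi.mul_apply]
  linear_combination (M.xiExt t * M.lam * (M.lam * t + Real.log M.h)) * h5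

/-- The condition determines the switch time. -/
theorem existsUnique_switchTime : ∃! t₀, M.IsSwitchTime t₀ := by
  have hcont : Continuous M.switchFun :=
    continuous_iff_continuousAt.2 fun t => (M.hasDerivAt_switchFun t).continuousAt
  have hc : Continuous fun s : ℝ => M.xiExt s * (M.lam * Real.exp (-(M.lam * s))) := by
    have := M.continuous_xiExt
    fun_prop
  have hnn : ∀ s, 0 ≤ M.xiExt s * (M.lam * Real.exp (-(M.lam * s))) := fun s =>
    mul_nonneg (M.xiExt_nonneg s) (mul_nonneg M.lam_pos.le (Real.exp_pos _).le)
  have hTpos : 0 < M.switchFun M.T := by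
    simpa [switchFun] using mul_pos M.lam_pos (M.integral_xiExt_pos M.T_pos)
  have h0 : M.switchFun 0 ≤ 0 := by
    have : 0 ≤ ∫ s in (0 : ℝ)..M.T, M.xiExt s * (M.lam * Real.exp (-(M.lam * s))) :=
      intervalIntegral.integral_nonneg M.T_pos.le fun s _ => hnn s
    simpa [switchFun] using mul_nonneg this M.log_h_pos.le
  obtain ⟨t₀, ht₀, hz⟩ := intermediate_value_Icc M.T_pos.le hcont.continuousOn ⟨h0, hTpos.le⟩
  have hlt : t₀ < M.T := lt_of_le_of_ne ht₀.2 fun h => by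
    rw [h] at hz; exact hTpos.ne' hz
  refine ⟨t₀, (M.isSwitchTime_iff t₀).2 ⟨⟨ht₀.1, hlt⟩, hz⟩, ?_⟩
  have key : ∀ a b : ℝ, a ∈ Ico 0 M.T → b ∈ Ico 0 M.T → M.switchFun a = 0 → M.switchFun b = 0 →
      ¬ a < b := by
    intro a b ha hb hza hzb hab
    obtain ⟨c, hcm, hder⟩ := exists_hasDerivAt_eq_zero hab hcont.continuousOn
      (hza.trans hzb.symm) fun x _ => M.hasDerivAt_switchFun x
    have hc0 : 0 ≤ c := ha.1.trans hcm.1.le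
    have hcT : c < M.T := hcm.2.trans hb.2
    have hfac : (1 + (M.lam * c + Real.log M.h)) ≠ 0 := by
      have := M.log_h_pos
      have := mul_nonneg M.lam_pos.le hc0
      positivity
    have hE := (mul_eq_zero.1 hder).resolve_right hfac
    -- the tail integral is less than it would be if the discount stayed at its value at `c`
    have hint : ∫ s in c..M.T, M.xiExt s * (M.lam * Real.exp (-(M.lam * s))) ≤
        M.xiExt c * (Real.exp (-(M.lam * c)) - Real.exp (-(M.lam * M.T))) := by
      have hd : ∀ s : ℝ, HasDerivAt (fun u : ℝ => -Real.exp (-(M.lam * u)))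
          (M.lam * Real.exp (-(M.lam * s))) s := by
        intro s
        have := (((hasDerivAt_id s).const_mul M.lam).neg.exp).neg
        refine this.congr_deriv ?_
        simp; ring
      have hi := intervalIntegral.integral_eq_sub_of_hasDerivAt (a := c) (b := M.T)
        (fun s _ => hd s) (Continuous.intervalIntegrable (by fun_prop) _ _)
      have hle : ∫ s in c..M.T, M.xiExt s * (M.lam * Real.exp (-(M.lam * s))) ≤
          ∫ s in c..M.T, M.xiExt c * (M.lam * Real.exp (-(M.lam * s))) := by
        refine intervalIntegral.integral_mono_on hcT.le (hc.intervalIntegrable _ _)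
          (Continuous.intervalIntegrable (by fun_prop) _ _) fun s hs => ?_
        exact mul_le_mul_of_nonneg_right (M.antitone_xiExt hs.1)
          (mul_nonneg M.lam_pos.le (Real.exp_pos _).le)
      rw [intervalIntegral.integral_const_mul, hi] at hle
      linarith
    have h5 : Real.exp (M.lam * c) * Real.exp (-(M.lam * c)) = 1 := by
      rw [← Real.exp_add]; simp
    have hxc : M.xiExt c = 0 := by
      have h6 : M.xiExt c = Real.exp (M.lam * c) *
          ∫ s in c..M.T, M.xiExt s * (M.lam * Real.exp (-(M.lam * s))) := by
        have := M.lam_pos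
        apply mul_left_cancel₀ this.ne'
        linarith
      have h7 := mul_le_mul_of_nonneg_left hint (Real.exp_pos (M.lam * c)).le
      rw [← h6] at h7
      have h8 : 0 < Real.exp (M.lam * c) * Real.exp (-(M.lam * M.T)) := by positivity
      have h9 := M.xiExt_nonneg c
      have h10 : M.xiExt c * (Real.exp (M.lam * c) * Real.exp (-(M.lam * M.T))) ≤ 0 := by
        linear_combination h7 + M.xiExt c * h5
      by_contra hne
      have := mul_pos (lt_of_le_of_ne h9 (Ne.symm hne)) h8
      linarith
    have htail : ∫ s in b..M.T, M.xiExt s * (M.lam * Real.exp (-(M.lam * s))) = 0 := by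
      have hcg : ∫ s in b..M.T, M.xiExt s * (M.lam * Real.exp (-(M.lam * s))) =
          ∫ s in b..M.T, (0 : ℝ) := by
        refine intervalIntegral.integral_congr fun s hs => ?_
        rw [uIcc_of_le hb.2.le] at hs
        have : M.xiExt s = 0 := le_antisymm
          (hxc ▸ M.antitone_xiExt (hcm.2.le.trans hs.1)) (M.xiExt_nonneg s)
        simp [this]
      simpa using hcg
    have hbpos : 0 < b := ha.1.trans_lt hab
    have := mul_pos M.lam_pos (M.integral_xiExt_pos hbpos)
    rw [switchFun, htail] at hzb
    simp only [mul_zero, zero_mul, sub_zero] at hzb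
    exact this.ne' hzb
  intro y hy
  obtain ⟨hy1, hy2⟩ := (M.isSwitchTime_iff y).1 hy
  rcases lt_trichotomy y t₀ with hl | he | hg
  · exact absurd hl (key _ _ hy1 ⟨ht₀.1, hlt⟩ hy2 hz)
  · exact he
  · exact absurd hg (key _ _ ⟨ht₀.1, hlt⟩ hy1 hz hy2)

/-- The time `t₀` from which `M_C` posts the minimum price. -/
def switchTime : ℝ := M.existsUnique_switchTime.choose

/-- The constant `k` of `M_C`. -/
def kConst : ℝ := M.slopeConst M.switchTime

/-- The pricing strategy of `M_C`. On `[0, t₀)` it is `a * exp (B t)` with `a = h`, where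
`B t = lam * t - (lam / k) * ∫ s in 0..t, 1 / ζ s - log (ζ t)`, for `ζ = 1 / xi`, is the
antiderivative of `lam - lam / (k * ζ) - ζ' / ζ` that vanishes at `0`. -/
def priceC (t : ℝ) : ℝ :=
  if t < M.switchTime then
    M.h * M.xi t * Real.exp (M.lam * t - M.lam / M.kConst * ∫ s in (0 : ℝ)..t, M.xi s)
  else M.xi t

/-- The ratio between the prices of `M_C` at the endpoints of `[s, s + τ]` (with `x / 0 = ∞` for
`x > 0` and `0 / 0 = 0`). -/
def priceRatio (τ s : ℝ) : ℝ≥0∞ :=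
  ENNReal.ofReal (M.priceC s) / ENNReal.ofReal (M.priceC (s + τ))

/-- The maximal price ratio of `M_C` over the intervals `[s, s + τ]` with `0 ≤ s ≤ b`. -/
def maxPriceRatioUpTo (b τ : ℝ) : ℝ≥0∞ := ⨆ s ∈ Icc 0 b, M.priceRatio τ s

/-- The maximal price ratio of `M_C` over all intervals of length `τ` in `[0, T]`. -/
def maxPriceRatio (τ : ℝ) : ℝ≥0∞ := M.maxPriceRatioUpTo (M.T - τ) τ

/-- The bound on the competitive ratio in terms of a price ratio `κ`. -/
def ratioBound (ε : ℝ) (κ : ℝ≥0∞) : ℝ≥0∞ :=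
  ENNReal.ofReal
      (M.xi (M.switchTime + M.T ^ (1 - ε) * M.lam ^ (-ε)) * (1 - ε)) /
    (κ * ENNReal.ofReal (Real.exp 1))

end Market

end PostedPrice

end

/-! Write S for the survival function of F and G_D(t) = 1 - exp(-D S(t)) for the probability that,
among a Poisson number of agents with mean D, some valuation exceeds t. The proof compares benchmark
and mechanism through quantities v G_D(v), the revenue of a fixed price v.

Upper bound on the benchmark: no sale exceeds the largest valuation that arrives, so with D = λT the
benchmark is at most ∫ G_D (`expectedRevenue_le`). A monotone hazard rate makes S log-concave, and
G_D inherits this. At a maximizer v of v G_D(v) the first-order condition puts G_D below the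
exponential G_D(v) exp(1 - t/v), whose integral over (0, ∞) is e v G_D(v)
(`exists_price_lintegral_maxSurvival_le`). The maximum is taken only over prices with D S(v) ≤ 1,
which the next step needs.

Fewer agents: M_C is credited only with the agents of a window of length τ, whose expected number is
λτ = D^(1-ε). Replacing v by v' = 1 + (1-ε)(v - 1) compensates: log-concavity and S(1) = 1 give
S(v') ≥ S(v)^(1-ε), so D^(1-ε) S(v') ≥ (D S(v))^(1-ε) ≥ D S(v), while v' ≥ (1-ε) v
(`mul_maxSurvival_le`).

Lower bound for M_C: the threshold p_C/ξ falls continuously from h to 1 on [0, t₀], hence equals v'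
at some s ≤ t₀. Agents above v' who arrive in [s, s+τ) accept, and no earlier price is below
p_C(s+τ) ≥ p_C(s)/κ, where p_C(s) = v' ξ(s) ≥ v' ξ(t₀+τ) (`le_expectedRevenue_priceC`). Only windows
starting by t₀ occur, which gives the sharper κ.

Both revenue bounds rest on the law of thinned Poisson arrivals, derived from the i.i.d. waiting
times in `noHitProb_eq`. -/

noncomputable section

/-! ### Conditioning on the first agent: the renewal equation. -/

namespace PostedPrice

/-- Prepending an independent sample to an i.i.d. sequence gives an i.i.d. sequence. -/
lemma map_cons_infinitePi {X : Type*} [MeasurableSpace X] (P : Measure X)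
    [IsProbabilityMeasure P] :
    (P.prod (Measure.infinitePi fun _ : ℕ => P)).map
      (fun z : X × (ℕ → X) => fun n => Nat.casesOn (motive := fun _ => X) n z.1 z.2) =
      Measure.infinitePi fun _ : ℕ => P := by
  have hmeas : Measurable
      (fun z : X × (ℕ → X) => fun n => Nat.casesOn (motive := fun _ => X) n z.1 z.2) := by
    refine measurable_pi_lambda _ fun n => ?_
    cases n with
    | zero => exact measurable_fst
    | succ n => exact (measurable_pi_apply n).comp measurable_snd
  refine Measure.eq_infinitePi _ fun s t ht => ?_
  classical
  obtain ⟨N, hN⟩ : ∃ N, s ⊆ Finset.range (N + 1) :=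
    ⟨s.sup id, fun i hi => Finset.mem_range.2 (Nat.lt_succ_of_le (Finset.le_sup (f := id) hi))⟩
  -- Padding the box with `univ` turns the index set into an initial segment, from which coordinate
  -- `0` splits off.
  set t' : ℕ → Set X := fun i => if i ∈ s then t i else univ with ht'
  have hm' : ∀ i, MeasurableSet (t' i) := fun i => by
    by_cases hi : i ∈ s
    · simpa [ht', hi] using ht i
    · simp [ht', hi]
  have hpre : (fun z : X × (ℕ → X) => fun n => Nat.casesOn (motive := fun _ => X) n z.1 z.2) ⁻¹'
      (Set.pi s t) = t' 0 ×ˢ Set.pi (Finset.range N) (fun i => t' (i + 1)) := by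
    ext z
    simp only [mem_preimage, Set.mem_pi, mem_prod, Finset.mem_coe, Finset.mem_range]
    constructor
    · intro hz
      refine ⟨?_, fun i _ => ?_⟩
      · by_cases h0 : 0 ∈ s
        · simpa [ht', h0] using hz 0 h0
        · simp [ht', h0]
      · by_cases h0 : i + 1 ∈ s
        · simpa [ht', h0] using hz (i + 1) h0
        · simp [ht', h0]
    · rintro ⟨h0, h1⟩ i hi
      cases i with
      | zero => simpa [ht', hi] using h0
      | succ i =>
        have := h1 i (by have := Finset.mem_range.1 (hN hi); omega)
        simpa [ht', hi] using this
  have hprod : ∏ i ∈ s, P (t i) = ∏ i ∈ Finset.range (N + 1), P (t' i) := by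
    rw [← Finset.prod_subset hN (f := fun i => P (t' i)) fun i _ hi => by simp [ht', hi]]
    exact Finset.prod_congr rfl fun i hi => by simp [ht', hi]
  rw [Measure.map_apply hmeas (MeasurableSet.pi s.countable_toSet fun i _ => ht i), hpre,
    Measure.prod_prod, Measure.infinitePi_pi _ fun i _ => hm' (i + 1), hprod,
    Finset.prod_range_succ', mul_comm]

namespace Market

variable (M : Market)

instance isProbabilityMeasure_agentsLaw (F : ProbabilityMeasure ℝ) :
    IsProbabilityMeasure (M.agentsLaw F) := by
  unfold agentsLaw; infer_instance

lemma measurable_arrivalTime (i : ℕ) : Measurable fun ω => arrivalTime ω i := by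
  unfold arrivalTime
  exact Finset.measurable_sum _ fun j _ => measurable_fst.comp (measurable_pi_apply j)

lemma measurable_valuation (i : ℕ) : Measurable fun ω => valuation ω i :=
  measurable_snd.comp (measurable_pi_apply i)

/-- When the clock starts at `s`, no agent with a valuation in `A` arrives in `[a, b)`. -/
def NoHit (a b : ℝ) (A : Set ℝ) (s : ℝ) (ω : ℕ → ℝ × ℝ) : Prop :=
  ∀ i, ¬ (s + arrivalTime ω i ∈ Ico a b ∧ valuation ω i ∈ A)

lemma measurableSet_noHit (a b : ℝ) {A : Set ℝ} (hA : MeasurableSet A) :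
    MeasurableSet {z : ℝ × (ℕ → ℝ × ℝ) | NoHit a b A z.1 z.2} := by
  have : {z : ℝ × (ℕ → ℝ × ℝ) | NoHit a b A z.1 z.2} =
      ⋂ i, {z : ℝ × (ℕ → ℝ × ℝ) |
        z.1 + arrivalTime z.2 i ∈ Ico a b ∧ valuation z.2 i ∈ A}ᶜ := by
    ext z; simp [NoHit]
  rw [this]
  refine MeasurableSet.iInter fun i => MeasurableSet.compl (MeasurableSet.inter ?_ ?_)
  · exact (measurable_fst.add ((measurable_arrivalTime i).comp measurable_snd)) measurableSet_Ico
  · exact ((measurable_valuation i).comp measurable_snd) hA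

/-- The free starting clock makes the event self-similar: without the first agent it is the same
event, with the clock advanced by her waiting time. -/
lemma noHit_cons (a b : ℝ) (A : Set ℝ) (s : ℝ) (x : ℝ × ℝ) (ω : ℕ → ℝ × ℝ) :
    NoHit a b A s (fun n => Nat.casesOn (motive := fun _ => ℝ × ℝ) n x ω) ↔
      ¬ (s + x.1 ∈ Ico a b ∧ x.2 ∈ A) ∧ NoHit a b A (s + x.1) ω := by
  have h0 : arrivalTime (fun n => Nat.casesOn (motive := fun _ => ℝ × ℝ) n x ω) 0 = x.1 := by
    simp [arrivalTime]
  have h1 : ∀ i, arrivalTime (fun n => Nat.casesOn (motive := fun _ => ℝ × ℝ) n x ω) (i + 1) =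
      x.1 + arrivalTime ω i := fun i => by
    unfold arrivalTime
    rw [Finset.sum_range_succ', add_comm]
    rfl
  constructor
  · intro h
    refine ⟨?_, fun i => ?_⟩
    · have := h 0
      rwa [h0] at this
    · have := h (i + 1)
      rwa [h1, ← add_assoc] at this
  · rintro ⟨h2, h3⟩ i
    cases i with
    | zero => rwa [h0]
    | succ i => rw [h1, ← add_assoc]; exact h3 i

/-- The probability that no agent with a valuation in `A` arrives in `[a, b)` when the clock
starts at `s`. -/
def noHitProb (F : ProbabilityMeasure ℝ) (a b : ℝ) (A : Set ℝ) (s : ℝ) : ℝ :=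
  (M.agentsLaw F).real {ω | NoHit a b A s ω}

lemma measurable_noHitProb (F : ProbabilityMeasure ℝ) (a b : ℝ) {A : Set ℝ}
    (hA : MeasurableSet A) : Measurable (M.noHitProb F a b A) :=
  (measurable_measure_prodMk_left (measurableSet_noHit a b hA)).ennreal_toReal

lemma noHitProb_nonneg (F : ProbabilityMeasure ℝ) (a b : ℝ) (A : Set ℝ) (s : ℝ) :
    0 ≤ M.noHitProb F a b A s := measureReal_nonneg

lemma noHitProb_le_one (F : ProbabilityMeasure ℝ) (a b : ℝ) (A : Set ℝ) (s : ℝ) :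
    M.noHitProb F a b A s ≤ 1 := measureReal_le_one

/-- The probability that an agent who arrives at time `t` has her arrival in `[a, b)` and her
valuation in `A`. -/
def hitRate (F : ProbabilityMeasure ℝ) (a b : ℝ) (A : Set ℝ) (t : ℝ) : ℝ :=
  (Ico a b).indicator (fun _ => (F : Measure ℝ).real A) t

lemma measurable_hitRate (F : ProbabilityMeasure ℝ) (a b : ℝ) (A : Set ℝ) :
    Measurable (hitRate F a b A) := measurable_const.indicator measurableSet_Ico

lemma hitRate_nonneg (F : ProbabilityMeasure ℝ) (a b : ℝ) (A : Set ℝ) (t : ℝ) :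
    0 ≤ hitRate F a b A t := indicator_nonneg (fun _ _ => measureReal_nonneg) t

lemma hitRate_le_one (F : ProbabilityMeasure ℝ) (a b : ℝ) (A : Set ℝ) (t : ℝ) :
    hitRate F a b A t ≤ 1 :=
  indicator_apply_le' (fun _ => measureReal_le_one) fun _ => zero_le_one

/-- Conditioning on the first agent. -/
lemma noHitProb_eq_integral (F : ProbabilityMeasure ℝ) (a b : ℝ) {A : Set ℝ}
    (hA : MeasurableSet A) (s : ℝ) :
    M.noHitProb F a b A s =
      ∫ g, (1 - hitRate F a b A (s + g)) * M.noHitProb F a b A (s + g) ∂(expMeasure M.lam) := by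
  set P : Measure (ℝ × ℝ) := (expMeasure M.lam).prod (F : Measure ℝ)
  have hmeas : Measurable
      (fun z : (ℝ × ℝ) × (ℕ → ℝ × ℝ) => fun n =>
        Nat.casesOn (motive := fun _ => ℝ × ℝ) n z.1 z.2) := by
    refine measurable_pi_lambda _ fun n => ?_
    cases n with
    | zero => exact measurable_fst
    | succ n => exact (measurable_pi_apply n).comp measurable_snd
  have hset : MeasurableSet {ω | NoHit a b A s ω} :=
    measurable_prodMk_left (x := s) (measurableSet_noHit a b hA)
  have hpre := hmeas hset
  have hB : MeasurableSet {x : ℝ × ℝ | ¬ (s + x.1 ∈ Ico a b ∧ x.2 ∈ A)} :=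
    (MeasurableSet.inter ((measurable_const.add measurable_fst) measurableSet_Ico)
      (measurable_snd hA)).compl
  have hU : ∀ x : ℝ × ℝ, M.agentsLaw F {ω | ¬ (s + x.1 ∈ Ico a b ∧ x.2 ∈ A) ∧
      NoHit a b A (s + x.1) ω} = ENNReal.ofReal
        ({x : ℝ × ℝ | ¬ (s + x.1 ∈ Ico a b ∧ x.2 ∈ A)}.indicator
          (fun x => M.noHitProb F a b A (s + x.1)) x) := by
    intro x
    by_cases hx : ¬ (s + x.1 ∈ Ico a b ∧ x.2 ∈ A)
    · rw [indicator_of_mem (by exact hx)]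
      simp only [hx, not_false_eq_true, true_and, noHitProb]
      rw [ofReal_measureReal]
    · rw [indicator_of_notMem (by exact hx)]
      simp only [hx, false_and, ofPred_false, measure_empty, ENNReal.ofReal_zero]
  have hmi : Measurable ({x : ℝ × ℝ | ¬ (s + x.1 ∈ Ico a b ∧ x.2 ∈ A)}.indicator
      (fun x => M.noHitProb F a b A (s + x.1))) :=
    ((M.measurable_noHitProb F a b hA).comp (measurable_const.add measurable_fst)).indicator hB
  have hbd : ∀ x, ‖{x : ℝ × ℝ | ¬ (s + x.1 ∈ Ico a b ∧ x.2 ∈ A)}.indicator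
      (fun x => M.noHitProb F a b A (s + x.1)) x‖ ≤ 1 := fun x => by
    rw [Real.norm_eq_abs, abs_of_nonneg
      (indicator_nonneg (fun _ _ => M.noHitProb_nonneg F a b A _) x)]
    exact indicator_apply_le' (fun _ => M.noHitProb_le_one F a b A _) fun _ => zero_le_one
  have hint : Integrable ({x : ℝ × ℝ | ¬ (s + x.1 ∈ Ico a b ∧ x.2 ∈ A)}.indicator
      (fun x => M.noHitProb F a b A (s + x.1))) P :=
    Integrable.of_bound hmi.aestronglyMeasurable 1 (Filter.Eventually.of_forall hbd)
  have h1 : M.noHitProb F a b A s = ∫ x, {x : ℝ × ℝ | ¬ (s + x.1 ∈ Ico a b ∧ x.2 ∈ A)}.indicator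
      (fun x => M.noHitProb F a b A (s + x.1)) x ∂P := by
    rw [integral_eq_lintegral_of_nonneg_ae (Filter.Eventually.of_forall fun x =>
      indicator_nonneg (fun _ _ => M.noHitProb_nonneg F a b A _) x) hmi.aestronglyMeasurable]
    rw [noHitProb, measureReal_def]
    congr 1
    conv_lhs => rw [agentsLaw, ← map_cons_infinitePi]
    rw [Measure.map_apply hmeas hset, Measure.prod_apply hpre]
    refine lintegral_congr fun x => ?_
    rw [← hU x]
    refine congrArg _ ?_
    ext ω
    exact noHit_cons a b A s x ω
  rw [h1, integral_prod _ hint]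
  refine integral_congr_ae (Filter.Eventually.of_forall fun g => ?_)
  have h2 : ∀ v, {x : ℝ × ℝ | ¬ (s + x.1 ∈ Ico a b ∧ x.2 ∈ A)}.indicator
      (fun x => M.noHitProb F a b A (s + x.1)) (g, v) =
      {v | ¬ (s + g ∈ Ico a b ∧ v ∈ A)}.indicator (fun _ => M.noHitProb F a b A (s + g)) v := by
    intro v; rfl
  simp only [h2]
  by_cases hg : s + g ∈ Ico a b
  · have : {v | ¬ (s + g ∈ Ico a b ∧ v ∈ A)} = Aᶜ := by ext v; simp [hg]
    rw [this, integral_indicator_const _ hA.compl, probReal_compl_eq_one_sub hA, hitRate,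
      indicator_of_mem hg, smul_eq_mul]
  · have : {v | ¬ (s + g ∈ Ico a b ∧ v ∈ A)} = univ := by
      ext v; simp only [mem_ofPred_eq, mem_univ, iff_true]; exact fun h => hg h.1
    rw [this, indicator_univ, hitRate, indicator_of_notMem hg]
    simp

end Market
end PostedPrice

/-! ### The Poisson law of the agents with valuations in a given set. -/

namespace PostedPrice
namespace Market

variable (M : Market)

lemma integral_expMeasure {r : ℝ} (hr : 0 < r) (f : ℝ → ℝ) :
    ∫ x, f x ∂(expMeasure r) = ∫ x in Ioi 0, r * Real.exp (-(r * x)) * f x := by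
  have h1 : expMeasure r = volume.withDensity (exponentialPDF r) := rfl
  have hm : Measurable (exponentialPDF r) :=
    (measurable_exponentialPDFReal r).ennreal_ofReal
  rw [h1, integral_withDensity_eq_integral_toReal_smul hm
    (Filter.Eventually.of_forall fun x => ENNReal.ofReal_lt_top), ← integral_Ici_eq_integral_Ioi,
    ← integral_indicator measurableSet_Ici]
  refine integral_congr_ae (Filter.Eventually.of_forall fun x => ?_)
  simp only [exponentialPDF_eq]
  by_cases hx : 0 ≤ x
  · rw [if_pos hx, indicator_of_mem (mem_Ici.2 hx), ENNReal.toReal_ofReal (by positivity),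
      smul_eq_mul]
  · rw [if_neg hx, indicator_of_notMem (by simpa using hx)]
    simp

/-- The no-hit probability predicted by the Poisson law. -/
def poissonNoHit (F : ProbabilityMeasure ℝ) (a b : ℝ) (A : Set ℝ) (s : ℝ) : ℝ :=
  Real.exp (-(M.lam * (F : Measure ℝ).real A * max 0 (b - max s a)))

lemma continuous_poissonNoHit (F : ProbabilityMeasure ℝ) (a b : ℝ) (A : Set ℝ) :
    Continuous (M.poissonNoHit F a b A) := by
  unfold poissonNoHit
  fun_prop

lemma poissonNoHit_nonneg (F : ProbabilityMeasure ℝ) (a b : ℝ) (A : Set ℝ) (s : ℝ) :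
    0 ≤ M.poissonNoHit F a b A s := (Real.exp_pos _).le

lemma poissonNoHit_le_one (F : ProbabilityMeasure ℝ) (a b : ℝ) (A : Set ℝ) (s : ℝ) :
    M.poissonNoHit F a b A s ≤ 1 := by
  unfold poissonNoHit
  have := M.lam_pos
  have : 0 ≤ (F : Measure ℝ).real A := measureReal_nonneg
  rw [Real.exp_le_one_iff]
  have : 0 ≤ max 0 (b - max s a) := le_max_left _ _
  have : 0 ≤ M.lam * (F : Measure ℝ).real A * max 0 (b - max s a) := by positivity
  linarith

/-- There may be a kink at `a`, where the hit rate jumps, so the derivative is taken from the right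
only; the fundamental theorem of calculus needs no more. -/
lemma hasDerivWithinAt_poissonNoHit (F : ProbabilityMeasure ℝ) {a b : ℝ} (hab : a ≤ b)
    (A : Set ℝ) {t : ℝ} (ht : t < b) :
    HasDerivWithinAt (M.poissonNoHit F a b A)
      (M.lam * hitRate F a b A t * M.poissonNoHit F a b A t) (Ioi t) t := by
  by_cases hta : t < a
  · have h1 : hitRate F a b A t = 0 := indicator_of_notMem (fun h => hta.not_ge h.1) _
    rw [h1, mul_zero, zero_mul]
    have h2 : HasDerivAt (fun _ : ℝ => Real.exp (-(M.lam * (F : Measure ℝ).real A * (b - a))))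
        0 t := hasDerivAt_const _ _
    refine (h2.congr_of_eventuallyEq ?_).hasDerivWithinAt
    filter_upwards [Iio_mem_nhds hta] with x hx
    rw [poissonNoHit, max_eq_right (le_of_lt (mem_Iio.1 hx)), max_eq_right (by linarith)]
  · push Not at hta
    have h1 : hitRate F a b A t = (F : Measure ℝ).real A :=
      indicator_of_mem (mem_Ico.2 ⟨hta, ht⟩) _
    have h2 : ∀ x, a ≤ x → x ≤ b → M.poissonNoHit F a b A x =
        Real.exp (-(M.lam * (F : Measure ℝ).real A * (b - x))) := fun x hx hx' => by
      rw [poissonNoHit, max_eq_left hx, max_eq_right (by linarith)]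
    have h3 : HasDerivAt (fun x : ℝ => Real.exp (-(M.lam * (F : Measure ℝ).real A * (b - x))))
        (Real.exp (-(M.lam * (F : Measure ℝ).real A * (b - t))) *
          (M.lam * (F : Measure ℝ).real A)) t := by
      have := (((hasDerivAt_id t).const_sub b).const_mul
        (M.lam * (F : Measure ℝ).real A)).neg.exp
      simpa using this
    have h4 : HasDerivWithinAt (M.poissonNoHit F a b A)
        (Real.exp (-(M.lam * (F : Measure ℝ).real A * (b - t))) *
          (M.lam * (F : Measure ℝ).real A)) (Ioi t) t := by
      refine h3.hasDerivWithinAt.congr_of_eventuallyEq ?_ (h2 t hta ht.le)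
      filter_upwards [Ioo_mem_nhdsGT ht] with x hx
      exact h2 x (hta.trans hx.1.le) hx.2.le
    refine h4.congr_deriv ?_
    rw [h1, h2 t hta ht.le]
    ring

/-- Up to `g = b - s` the integrand has the antiderivative `-exp (-lam g) * poissonNoHit (s + g)`.
Beyond it no hit is possible, and the remaining exponential mass cancels the boundary term at `b -
s`. -/
lemma poissonNoHit_eq_integral (F : ProbabilityMeasure ℝ) {a b : ℝ} (hab : a ≤ b) {A : Set ℝ}
    {s : ℝ} (hs : s < b) :
    M.poissonNoHit F a b A s =
      ∫ g, (1 - hitRate F a b A (s + g)) * M.poissonNoHit F a b A (s + g)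
        ∂(expMeasure M.lam) := by
  have hl := M.lam_pos
  rw [integral_expMeasure hl]
  set f : ℝ → ℝ := fun g => M.lam * Real.exp (-(M.lam * g)) *
    ((1 - hitRate F a b A (s + g)) * M.poissonNoHit F a b A (s + g)) with hf
  have hfm : Measurable f := by
    have h1 := (measurable_hitRate F a b A).comp (measurable_const_add s)
    have h2 := (M.continuous_poissonNoHit F a b A).measurable.comp (measurable_const_add s)
    have h3 : Measurable fun g : ℝ => M.lam * Real.exp (-(M.lam * g)) := by fun_prop
    exact h3.mul ((measurable_const.sub h1).mul h2)
  have hfi : IntegrableOn f (Ioi 0) := by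
    have h0 : IntegrableOn (fun g : ℝ => M.lam * Real.exp (-M.lam * g)) (Ioi 0) :=
      (exp_neg_integrableOn_Ioi 0 hl).const_mul _
    refine Integrable.mono' h0 hfm.aestronglyMeasurable (Filter.Eventually.of_forall fun g => ?_)
    have h1 := hitRate_nonneg F a b A (s + g)
    have h2 := hitRate_le_one F a b A (s + g)
    have h3 := M.poissonNoHit_nonneg F a b A (s + g)
    have h4 := M.poissonNoHit_le_one F a b A (s + g)
    have h5 : 0 ≤ (1 - hitRate F a b A (s + g)) * M.poissonNoHit F a b A (s + g) :=
      mul_nonneg (by linarith) h3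
    have h6 : 0 ≤ M.lam * Real.exp (-(M.lam * g)) := by positivity
    rw [Real.norm_eq_abs, abs_of_nonneg (mul_nonneg h6 h5), neg_mul]
    refine mul_le_of_le_one_right h6 (mul_le_one₀ (by linarith) h3 h4)
  have hsplit : Ioi (0 : ℝ) = Ioc 0 (b - s) ∪ Ioi (b - s) :=
    (Ioc_union_Ioi_eq_Ioi (by linarith)).symm
  rw [hsplit, setIntegral_union (Ioc_disjoint_Ioi le_rfl) measurableSet_Ioi
    (hfi.mono_set Ioc_subset_Ioi_self) (hfi.mono_set (Ioi_subset_Ioi (by linarith))),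
    ← intervalIntegral.integral_of_le (by linarith)]
  have hcont : Continuous fun g => -Real.exp (-(M.lam * g)) * M.poissonNoHit F a b A (s + g) := by
    have := M.continuous_poissonNoHit F a b A
    fun_prop
  have e1 : ∫ g in (0 : ℝ)..(b - s), f g =
      M.poissonNoHit F a b A s - Real.exp (-(M.lam * (b - s))) := by
    rw [intervalIntegral.integral_eq_sub_of_hasDeriv_right (f' := f) hcont.continuousOn
      (fun x hx => ?_) ((intervalIntegrable_iff_integrableOn_Ioc_of_le (by linarith)).2
        (hfi.mono_set Ioc_subset_Ioi_self))]
    · have : M.poissonNoHit F a b A b = 1 := by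
        simp [poissonNoHit, max_eq_left hab]
      simp [this]
      ring
    · rw [min_eq_left (by linarith), max_eq_right (by linarith)] at hx
      have h1 : HasDerivAt (fun g : ℝ => -Real.exp (-(M.lam * g)))
          (M.lam * Real.exp (-(M.lam * x))) x := by
        refine (((hasDerivAt_id x).const_mul M.lam).neg.exp).neg.congr_deriv ?_
        simp; ring
      have h2 := M.hasDerivWithinAt_poissonNoHit F hab A (t := s + x) (by linarith [hx.2])
      have h3 : HasDerivWithinAt (fun g : ℝ => s + g) 1 (Ioi x) x :=
        ((hasDerivAt_id x).const_add s).hasDerivWithinAt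
      have h4 := HasDerivWithinAt.scomp x h2 h3 (fun y hy => by
        simp only [mem_Ioi] at hy ⊢; linarith)
      refine (h1.hasDerivWithinAt.mul h4).congr_deriv ?_
      simp [hf]
      ring
  have e2 : ∫ g in Ioi (b - s), f g = Real.exp (-(M.lam * (b - s))) := by
    have h1 : ∫ g in Ioi (b - s), f g =
        ∫ g in Ioi (b - s), M.lam * Real.exp (-M.lam * g) := by
      refine setIntegral_congr_fun measurableSet_Ioi fun g hg => ?_
      have hg' : b < s + g := by have := mem_Ioi.1 hg; linarith
      have h2 : hitRate F a b A (s + g) = 0 := indicator_of_notMem (fun h => hg'.not_gt h.2) _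
      have h3 : M.poissonNoHit F a b A (s + g) = 1 := by
        rw [poissonNoHit, max_eq_left (by linarith [le_max_left (s + g) a])]
        simp
      simp [hf, h2, h3]
    rw [h1, integral_const_mul, integral_exp_mul_Ioi (by linarith)]
    field_simp
  rw [e1, e2]
  ring

lemma ae_expMeasure_pos {r : ℝ} (hr : 0 < r) : ∀ᵐ x ∂(expMeasure r), 0 < x := by
  have := isProbabilityMeasure_expMeasure hr
  have h1 : (expMeasure r).real (Iic 0) = 0 := by
    rw [← cdf_eq_real, cdf_expMeasure_eq hr]
    simp
  rw [ae_iff]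
  have h2 : {x : ℝ | ¬ 0 < x} = Iic 0 := by ext x; simp
  rw [h2]
  exact (measureReal_eq_zero_iff).1 h1

lemma ae_agentsLaw {F : ProbabilityMeasure ℝ} {Q : ℝ × ℝ → Prop}
    (hQ : ∀ᵐ x ∂((expMeasure M.lam).prod (F : Measure ℝ)), Q x) :
    ∀ᵐ ω ∂(M.agentsLaw F), ∀ i, Q (ω i) := by
  rw [ae_all_iff]
  intro i
  exact (measurePreserving_eval_infinitePi
    (fun _ : ℕ => (expMeasure M.lam).prod (F : Measure ℝ)) i).quasiMeasurePreserving.ae hQ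

lemma ae_gap_pos (F : ProbabilityMeasure ℝ) : ∀ᵐ ω ∂(M.agentsLaw F), ∀ i, 0 < (ω i).1 :=
  M.ae_agentsLaw (Q := fun x => 0 < x.1)
    (Measure.quasiMeasurePreserving_fst.ae (ae_expMeasure_pos M.lam_pos))

lemma strictMono_arrivalTime {ω : ℕ → ℝ × ℝ} (hω : ∀ i, 0 < (ω i).1) :
    StrictMono (arrivalTime ω) :=
  strictMono_nat_of_lt_succ fun n => by
    have := hω (n + 1)
    unfold arrivalTime
    rw [Finset.sum_range_succ _ (n + 1)]
    linarith

lemma arrivalTime_pos {ω : ℕ → ℝ × ℝ} (hω : ∀ i, 0 < (ω i).1) (i : ℕ) : 0 < arrivalTime ω i :=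
  Finset.sum_pos (fun j _ => hω j) ⟨0, by simp⟩

lemma noHitProb_eq_one (F : ProbabilityMeasure ℝ) (a b : ℝ) (A : Set ℝ) {s : ℝ} (hs : b ≤ s) :
    M.noHitProb F a b A s = 1 := by
  have h : ∀ᵐ ω ∂(M.agentsLaw F), ω ∈ {ω | NoHit a b A s ω} := by
    filter_upwards [M.ae_gap_pos F] with ω hω i hi
    have h1 := arrivalTime_pos hω i
    have h2 := hi.1.2
    linarith
  have h1 : {ω | NoHit a b A s ω} =ᵐ[M.agentsLaw F] univ := Filter.eventuallyEq_univ.2 h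
  rw [noHitProb, measureReal_def, measure_congr h1, measure_univ, ENNReal.toReal_one]

/-- The agents with a valuation in `A` form a Poisson process of rate `lam * F A`. -/
theorem noHitProb_eq (F : ProbabilityMeasure ℝ) {a b : ℝ} (hab : a ≤ b) {A : Set ℝ}
    (hA : MeasurableSet A) (s : ℝ) :
    M.noHitProb F a b A s = M.poissonNoHit F a b A s := by
  have hl := M.lam_pos
  have hone : ∀ t, b ≤ t → M.noHitProb F a b A t - M.poissonNoHit F a b A t = 0 := by
    intro t ht
    have h1 : max 0 (b - max t a) = 0 := max_eq_left (by linarith [le_max_left t a])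
    rw [M.noHitProb_eq_one F a b A ht, poissonNoHit, h1]
    simp
  rcases le_or_gt b s with hs | hs
  · linarith [hone s hs]
  -- The difference of the two solutions satisfies the homogeneous renewal equation and vanishes
  -- from `b` on; a contraction argument shows that it is zero.
  set w : ℝ → ℝ := fun t => M.noHitProb F a b A t - M.poissonNoHit F a b A t with hw
  have hint : ∀ (u : ℝ → ℝ), Measurable u → (∀ t, 0 ≤ u t) → (∀ t, u t ≤ 1) → ∀ t,
      Integrable (fun g => (1 - hitRate F a b A (t + g)) * u (t + g)) (expMeasure M.lam) := by
    intro u hum hu0 hu1 t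
    refine Integrable.of_bound ((measurable_const.sub
      ((measurable_hitRate F a b A).comp (measurable_const_add t))).mul
      (hum.comp (measurable_const_add t))).aestronglyMeasurable 1
      (Filter.Eventually.of_forall fun g => ?_)
    have h1 := hitRate_nonneg F a b A (t + g)
    have h2 := hitRate_le_one F a b A (t + g)
    rw [Real.norm_eq_abs, abs_of_nonneg (mul_nonneg (by linarith) (hu0 _))]
    exact mul_le_one₀ (by linarith) (hu0 _) (hu1 _)
  have hrec : ∀ t, t < b → w t =
      ∫ g, (1 - hitRate F a b A (t + g)) * w (t + g) ∂(expMeasure M.lam) := by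
    intro t ht
    simp only [hw, mul_sub]
    rw [integral_sub (hint _ (M.measurable_noHitProb F a b hA) (M.noHitProb_nonneg F a b A)
      (M.noHitProb_le_one F a b A) t) (hint _ (M.continuous_poissonNoHit F a b A).measurable
      (M.poissonNoHit_nonneg F a b A) (M.poissonNoHit_le_one F a b A) t),
      ← M.noHitProb_eq_integral F a b hA, ← M.poissonNoHit_eq_integral F hab ht]
  -- The contraction factor is the probability that a waiting time is at most `b - s`; from a clock
  -- `t ≥ s`, a longer one leads past `b`, where `w` vanishes.
  set ρ : ℝ := 1 - Real.exp (-(M.lam * (b - s))) with hρ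
  have hρ0 : 0 ≤ ρ := by
    have : 0 ≤ M.lam * (b - s) := mul_nonneg hl.le (by linarith)
    have : Real.exp (-(M.lam * (b - s))) ≤ 1 := Real.exp_le_one_iff.2 (by linarith)
    linarith
  have hρ1 : ρ < 1 := by have := Real.exp_pos (-(M.lam * (b - s))); linarith
  have hbound : ∀ n : ℕ, ∀ t, s ≤ t → |w t| ≤ ρ ^ n := by
    intro n
    induction n with
    | zero =>
      intro t _
      have h1 := M.noHitProb_nonneg F a b A t
      have h2 := M.noHitProb_le_one F a b A t
      have h3 := M.poissonNoHit_nonneg F a b A t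
      have h4 := M.poissonNoHit_le_one F a b A t
      rw [pow_zero, abs_le]
      constructor <;> simp only [hw] <;> linarith
    | succ n ih =>
      intro t ht
      rcases le_or_gt b t with hbt | hbt
      · simp only [hw, hone t hbt, abs_zero]; positivity
      have hle : ‖∫ g, (1 - hitRate F a b A (t + g)) * w (t + g) ∂(expMeasure M.lam)‖ ≤
          ∫ g, (Iic (b - t)).indicator (fun _ => ρ ^ n) g ∂(expMeasure M.lam) := by
        refine norm_integral_le_of_norm_le
          ((integrable_const _).indicator measurableSet_Iic) ?_
        filter_upwards [ae_expMeasure_pos hl] with g hg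
        have h1 := hitRate_nonneg F a b A (t + g)
        have h2 := hitRate_le_one F a b A (t + g)
        by_cases hgb : g ≤ b - t
        · rw [indicator_of_mem (mem_Iic.2 hgb), norm_mul, Real.norm_eq_abs, Real.norm_eq_abs,
            abs_of_nonneg (by linarith)]
          exact (mul_le_of_le_one_left (abs_nonneg _) (by linarith)).trans (ih _ (by linarith))
        · rw [indicator_of_notMem (by simpa using hgb)]
          simp only [hw, hone (t + g) (by linarith), mul_zero, norm_zero, le_refl]
      rw [integral_indicator_const _ measurableSet_Iic, ← cdf_eq_real, cdf_expMeasure_eq hl,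
        if_pos (by linarith), smul_eq_mul, ← hrec t hbt, Real.norm_eq_abs] at hle
      refine hle.trans ?_
      rw [pow_succ, mul_comm]
      refine mul_le_mul_of_nonneg_left ?_ (by positivity)
      have : Real.exp (-(M.lam * (b - s))) ≤ Real.exp (-(M.lam * (b - t))) :=
        Real.exp_le_exp.2 (by nlinarith)
      linarith
  have hlim := tendsto_pow_atTop_nhds_zero_of_lt_one hρ0 hρ1
  have h0 : |w s| ≤ 0 := ge_of_tendsto' hlim fun n => hbound n s le_rfl
  have := abs_eq_zero.1 (le_antisymm h0 (abs_nonneg _))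
  simp only [hw] at this
  linarith

/-- The probability that an agent with a valuation in `A` arrives in `[a, b)`. -/
theorem agentsLaw_hit (F : ProbabilityMeasure ℝ) {a b : ℝ} (ha : 0 ≤ a) (hab : a ≤ b)
    {A : Set ℝ} (hA : MeasurableSet A) :
    M.agentsLaw F {ω | ∃ i, arrivalTime ω i ∈ Ico a b ∧ valuation ω i ∈ A} =
      ENNReal.ofReal (1 - Real.exp (-(M.lam * (b - a) * (F : Measure ℝ).real A))) := by
  have hset : MeasurableSet {ω | NoHit a b A 0 ω} :=
    measurable_prodMk_left (x := (0 : ℝ)) (measurableSet_noHit a b hA)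
  have h1 : {ω | ∃ i, arrivalTime ω i ∈ Ico a b ∧ valuation ω i ∈ A} =
      {ω | NoHit a b A 0 ω}ᶜ := by
    ext ω
    simp only [NoHit, zero_add, mem_compl_iff, mem_ofPred_eq, not_forall, not_not]
  have h2 := M.noHitProb_eq F hab hA 0
  rw [h1, ← ofReal_measureReal, probReal_compl_eq_one_sub hset]
  rw [noHitProb] at h2
  rw [h2, poissonNoHit, max_eq_right ha, max_eq_right (by linarith)]
  congr 4
  ring

end Market
end PostedPrice

/-! ### Upper and lower bounds on the revenue of a posted price. -/

namespace PostedPrice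

/-- The probability that a valuation exceeds `t`. -/
def survival (F : ProbabilityMeasure ℝ) (t : ℝ) : ℝ := (F : Measure ℝ).real (Ioi t)

lemma survival_nonneg (F : ProbabilityMeasure ℝ) (t : ℝ) : 0 ≤ survival F t := measureReal_nonneg

lemma survival_le_one (F : ProbabilityMeasure ℝ) (t : ℝ) : survival F t ≤ 1 := measureReal_le_one

lemma antitone_survival (F : ProbabilityMeasure ℝ) : Antitone (survival F) := fun _ _ hab =>
  measureReal_mono (Ioi_subset_Ioi hab)

namespace Market

variable (M : Market)

lemma xi_nonneg {t : ℝ} (ht : 0 ≤ t) : 0 ≤ M.xi t := by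
  rcases le_total t M.T with h | h
  · rw [← M.xiExt_eq ⟨ht, h⟩]; exact M.xiExt_nonneg t
  · rw [M.xi_eq_zero t h]

lemma xi_le_one {t : ℝ} (ht : 0 ≤ t) : M.xi t ≤ 1 := by
  rcases le_total t M.T with h | h
  · rw [← M.xi_zero]
    exact M.xi_antitoneOn ⟨le_rfl, M.T_pos.le⟩ ⟨ht, h⟩ ht
  · rw [M.xi_eq_zero t h]; exact zero_le_one

/-- The sale at `p` does not yield more than the largest valuation that arrives before `T`. -/
lemma revenue_le_lintegral (p : ℝ → ℝ) {ω : ℕ → ℝ × ℝ} (hω : ∀ i, 0 < (ω i).1) :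
    M.revenue p ω ≤ ∫⁻ t in Ioi (0 : ℝ),
      {z : (ℕ → ℝ × ℝ) × ℝ |
          ∃ i, arrivalTime z.1 i ∈ Ico 0 M.T ∧ valuation z.1 i ∈ Ioi z.2}.indicator
        (fun _ => (1 : ℝ≥0∞)) (ω, t) := by
  classical
  unfold revenue
  split_ifs with hex
  swap
  · exact zero_le
  have hacc := Nat.find_spec hex
  generalize Nat.find hex = i at hacc
  obtain ⟨hT, hp⟩ := hacc
  have hW := arrivalTime_pos hω i
  generalize hWdef : arrivalTime ω i = W at hT hp hW
  rcases le_or_gt (p W) 0 with h0 | h0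
  · rw [ENNReal.ofReal_of_nonpos h0]; exact zero_le
  have hx0 := M.xi_nonneg hW.le
  have hx1 := M.xi_le_one hW.le
  have hV : 0 < valuation ω i := by
    by_contra hcon
    have := mul_nonpos_of_nonpos_of_nonneg (not_lt.1 hcon) hx0
    linarith
  -- An arrival exactly at the deadline has discount `0` and cannot pay a positive price, so the
  -- half-open interval loses nothing.
  have hWT : W < M.T := by
    refine lt_of_le_of_ne hT fun h => ?_
    rw [M.xi_eq_zero W h.ge, mul_zero] at hp
    linarith
  have hpV : p W ≤ valuation ω i := hp.trans (mul_le_of_le_one_right hV.le hx1)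
  -- Layer-cake form: the price is the length of `(0, p W)`, and each level there is exceeded by the
  -- buyer's valuation.
  calc ENNReal.ofReal (p W) = ∫⁻ t in Ioo 0 (p W), 1 := by
        rw [setLIntegral_one, Real.volume_Ioo, sub_zero]
    _ ≤ ∫⁻ t in Ioo 0 (p W), {z : (ℕ → ℝ × ℝ) × ℝ | ∃ i, arrivalTime z.1 i ∈ Ico 0 M.T ∧
          valuation z.1 i ∈ Ioi z.2}.indicator (fun _ => (1 : ℝ≥0∞)) (ω, t) := by
        refine setLIntegral_mono' measurableSet_Ioo fun t ht => ?_
        rw [indicator_of_mem]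
        refine ⟨i, ?_, ?_⟩
        · simp only [hWdef]
          exact ⟨hW.le, hWT⟩
        · exact mem_Ioi.2 (ht.2.trans_le hpV)
    _ ≤ _ := lintegral_mono_set Ioo_subset_Ioi_self

/-- The expected revenue of every posted-price mechanism is at most the expectation of the largest
valuation that arrives. -/
theorem expectedRevenue_le (F : ProbabilityMeasure ℝ) (p : ℝ → ℝ) :
    M.expectedRevenue F p ≤
      ∫⁻ t in Ioi (0 : ℝ), ENNReal.ofReal (1 - Real.exp (-(M.lam * M.T * survival F t))) := by
  set E : Set ((ℕ → ℝ × ℝ) × ℝ) :=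
    {z | ∃ i, arrivalTime z.1 i ∈ Ico 0 M.T ∧ valuation z.1 i ∈ Ioi z.2} with hE
  have hEm : MeasurableSet E := by
    have : E = ⋃ i, {z : (ℕ → ℝ × ℝ) × ℝ |
        arrivalTime z.1 i ∈ Ico 0 M.T ∧ valuation z.1 i ∈ Ioi z.2} := by
      ext z; simp [hE]
    rw [this]
    refine MeasurableSet.iUnion fun i => MeasurableSet.inter ?_ ?_
    · exact ((measurable_arrivalTime i).comp measurable_fst) measurableSet_Ico
    · exact measurableSet_lt measurable_snd ((measurable_valuation i).comp measurable_fst)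
  calc M.expectedRevenue F p
      ≤ ∫⁻ ω, (∫⁻ t in Ioi (0 : ℝ), E.indicator (fun _ => (1 : ℝ≥0∞)) (ω, t))
          ∂(M.agentsLaw F) := by
        refine lintegral_mono_ae ?_
        filter_upwards [M.ae_gap_pos F] with ω hω
        exact M.revenue_le_lintegral p hω
    _ = ∫⁻ t in Ioi (0 : ℝ), ∫⁻ ω, E.indicator (fun _ => (1 : ℝ≥0∞)) (ω, t) ∂(M.agentsLaw F) :=
        lintegral_lintegral_swap
          (f := fun ω t => E.indicator (fun _ => (1 : ℝ≥0∞)) (ω, t)) (measurable_const.indicator hEm).aemeasurable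
    _ = _ := by
        refine lintegral_congr fun t => ?_
        have h1 := M.agentsLaw_hit F le_rfl M.T_pos.le (measurableSet_Ioi (a := t))
        rw [sub_zero] at h1
        rw [survival, ← h1]
        have h2 : ∀ ω, E.indicator (fun _ => (1 : ℝ≥0∞)) (ω, t) =
            {ω | ∃ i, arrivalTime ω i ∈ Ico 0 M.T ∧ valuation ω i ∈ Ioi t}.indicator 1 ω :=
          fun ω => rfl
        simp only [h2]
        refine lintegral_indicator_one ?_
        exact measurable_prodMk_right (y := t) hEm

/-- If every agent with a valuation above `v` who arrives in `[s, s + τ)` accepts, and the price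
before `s + τ` is at least `c`, then the seller earns at least `c` whenever there is such an
agent. -/
theorem le_expectedRevenue (F : ProbabilityMeasure ℝ) {p : ℝ → ℝ} {s τ v c : ℝ} (hs : 0 ≤ s)
    (hτ : 0 ≤ τ) (hsT : s + τ ≤ M.T) (hacc : ∀ t ∈ Ico s (s + τ), p t ≤ v * M.xi t)
    (hlow : ∀ t ∈ Ico 0 (s + τ), c ≤ p t) :
    ENNReal.ofReal c * ENNReal.ofReal (1 - Real.exp (-(M.lam * τ * survival F v))) ≤
      M.expectedRevenue F p := by
  classical
  set E : Set (ℕ → ℝ × ℝ) :=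
    {ω | ∃ i, arrivalTime ω i ∈ Ico s (s + τ) ∧ valuation ω i ∈ Ioi v} with hE
  have hEm : MeasurableSet E := by
    have : E = ⋃ i, {ω | arrivalTime ω i ∈ Ico s (s + τ) ∧ valuation ω i ∈ Ioi v} := by
      ext ω; simp [hE]
    rw [this]
    exact MeasurableSet.iUnion fun i => MeasurableSet.inter
      (measurable_arrivalTime i measurableSet_Ico) (measurable_valuation i measurableSet_Ioi)
  have h1 := M.agentsLaw_hit F hs (by linarith : s ≤ s + τ) (measurableSet_Ioi (a := v))
  rw [add_sub_cancel_left] at h1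
  rw [survival, ← h1, ← lintegral_indicator_const hEm, expectedRevenue]
  refine lintegral_mono_ae ?_
  filter_upwards [M.ae_gap_pos F] with ω hω
  by_cases hmem : ω ∈ E
  swap
  · rw [indicator_of_notMem hmem]; exact zero_le
  rw [indicator_of_mem hmem]
  obtain ⟨i, hi, hv⟩ := hmem
  have hai : M.Accepts p ω i := by
    refine ⟨hi.2.le.trans hsT, (hacc _ hi).trans ?_⟩
    exact mul_le_mul_of_nonneg_right (le_of_lt hv) (M.xi_nonneg (arrivalTime_pos hω i).le)
  have hex : ∃ i, M.Accepts p ω i := ⟨i, hai⟩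
  rw [revenue, dif_pos hex]
  -- The buyer is the first accepting agent, hence arrives no later than agent `i`, before `s + τ`.
  refine ENNReal.ofReal_le_ofReal (hlow _ ⟨(arrivalTime_pos hω _).le, ?_⟩)
  exact ((strictMono_arrivalTime hω).monotone (Nat.find_min' hex hai)).trans_lt hi.2

end Market
end PostedPrice

/-! ### Log-concavity from a monotone hazard rate. -/

namespace PostedPrice

open Filter Topology in
/-- A non-negative function whose relative decrease over a step from `y` to `x` is at least
`c * (x - y)` to the right of `w` and at most that to the left of `w` lies below an exponential
function with rate `c` that touches it at `w`. -/
lemma le_mul_exp_of_increments {S : ℝ → ℝ} {c w : ℝ}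
    (hright : ∀ y x, w ≤ y → y ≤ x → c * (x - y) * S x ≤ S y - S x)
    (hleft : ∀ y x, y ≤ x → x ≤ w → S y - S x ≤ c * (x - y) * S y) (x : ℝ) :
    S x ≤ S w * Real.exp (-(c * (x - w))) := by
  -- The way from `w` to `x` is cut into `n` equal steps `δ`, each giving a factor `1 + c δ`;
  -- Euler's limit yields the exponential. No differentiability of `S` is used, as the density need
  -- not be continuous.
  have hlim := Real.tendsto_one_add_div_pow_exp (c * (x - w))
  suffices h : Real.exp (c * (x - w)) * S x ≤ S w by
    rw [Real.exp_neg, ← div_eq_mul_inv, le_div_iff₀ (Real.exp_pos _), mul_comm]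
    exact h
  have hlim2 : Tendsto (fun n : ℕ => (1 + c * (x - w) / n) ^ n * S x) atTop
      (𝓝 (Real.exp (c * (x - w)) * S x)) := hlim.mul_const _
  have hlim0 : Tendsto (fun n : ℕ => 1 + c * (x - w) / n) atTop (𝓝 (1 + 0)) :=
    tendsto_const_nhds.add (tendsto_const_div_atTop_nhds_zero_nat _)
  have hpos : ∀ᶠ n : ℕ in atTop, 0 < 1 + c * (x - w) / n :=
    hlim0.eventually (lt_mem_nhds (by norm_num))
  refine le_of_tendsto hlim2 ?_
  filter_upwards [hpos, eventually_gt_atTop 0] with n hn hn0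
  have hn0' : (0 : ℝ) < n := Nat.cast_pos.2 hn0
  set δ : ℝ := (x - w) / n with hδ
  have hfac : 1 + c * (x - w) / n = 1 + c * δ := by rw [hδ]; ring
  have hxw : w + n * δ = x := by rw [hδ]; field_simp; ring
  have hstep : ∀ k : ℕ, (1 + c * δ) * S (w + (k + 1) * δ) ≤ S (w + k * δ) := by
    intro k
    have hk : (0 : ℝ) ≤ k := Nat.cast_nonneg k
    rcases le_total w x with hwx | hwx
    · have hδ0 : 0 ≤ δ := div_nonneg (by linarith) hn0'.le
      have := hright (w + k * δ) (w + (k + 1) * δ) (by nlinarith) (by nlinarith)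
      ring_nf at this ⊢
      linarith
    · have hδ0 : δ ≤ 0 := div_nonpos_of_nonpos_of_nonneg (by linarith) hn0'.le
      have := hleft (w + (k + 1) * δ) (w + k * δ) (by nlinarith) (by nlinarith)
      ring_nf at this ⊢
      linarith
  rw [hfac] at hn ⊢
  have hind : ∀ k : ℕ, (1 + c * δ) ^ k * S (w + k * δ) ≤ S w := by
    intro k
    induction k with
    | zero => simp
    | succ k ih =>
      refine le_trans ?_ ih
      rw [pow_succ, mul_assoc]
      push_cast
      exact mul_le_mul_of_nonneg_left (hstep k) (by positivity)
  have := hind n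
  rwa [hxw] at this

lemma survival_eq_one_sub_cdf (F : ProbabilityMeasure ℝ) (t : ℝ) :
    survival F t = 1 - cdf (F : Measure ℝ) t := by
  rw [cdf_eq_real, survival, ← probReal_compl_eq_one_sub measurableSet_Iic, compl_Iic]

lemma integrable_density {F : ProbabilityMeasure ℝ} {f : ℝ → ℝ} (hf : Measurable f)
    (hF : (F : Measure ℝ) = volume.withDensity (fun x => ENNReal.ofReal (f x)))
    (hf0 : ∀ x, 0 ≤ f x) : Integrable f := by
  refine ⟨hf.aestronglyMeasurable, ?_⟩
  rw [hasFiniteIntegral_iff_ofReal (Filter.Eventually.of_forall hf0)]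
  have h1 : (F : Measure ℝ) univ = 1 := measure_univ
  rw [hF, withDensity_apply _ MeasurableSet.univ, setLIntegral_univ] at h1
  rw [h1]
  exact ENNReal.one_lt_top

lemma survival_sub_survival {F : ProbabilityMeasure ℝ} {f : ℝ → ℝ} (hf : Measurable f)
    (hF : (F : Measure ℝ) = volume.withDensity (fun x => ENNReal.ofReal (f x)))
    (hf0 : ∀ x, 0 ≤ f x) (y x : ℝ) :
    survival F y - survival F x = ∫ t in y..x, f t := by
  have hi := integrable_density hf hF hf0
  have h1 : ∀ t, survival F t = ∫ s in Ioi t, f s := by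
    intro t
    rw [survival, measureReal_def, hF, withDensity_apply _ measurableSet_Ioi,
      integral_eq_lintegral_of_nonneg_ae (Filter.Eventually.of_forall hf0)
        hf.aestronglyMeasurable]
  rw [h1, h1, intervalIntegral.integral_Ioi_sub_Ioi' hi.integrableOn hi.integrableOn]

lemma continuous_survival {F : ProbabilityMeasure ℝ} {f : ℝ → ℝ} (hf : Measurable f)
    (hF : (F : Measure ℝ) = volume.withDensity (fun x => ENNReal.ofReal (f x)))
    (hf0 : ∀ x, 0 ≤ f x) : Continuous (survival F) := by
  have h1 : survival F = fun x => survival F 0 - ∫ t in (0 : ℝ)..x, f t := by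
    ext x
    rw [← survival_sub_survival hf hF hf0]
    ring
  rw [h1]
  exact continuous_const.sub
    (intervalIntegral.continuous_primitive
      (fun a b => (integrable_density hf hF hf0).intervalIntegrable) 0)

lemma Market.IsMHR.continuous_survival {F : ProbabilityMeasure ℝ} (hF : Market.IsMHR F) :
    Continuous (survival F) := by
  obtain ⟨f, hf, hf0, hFf, -⟩ := hF
  exact PostedPrice.continuous_survival hf hFf hf0

/-- A monotone hazard rate bounds the survival function by exponential functions that touch it. -/
lemma Market.IsMHR.exists_survival_le_exp {F : ProbabilityMeasure ℝ} (hF : Market.IsMHR F) {w : ℝ}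
    (hw : 0 < survival F w) :
    ∃ c, ∀ x, survival F x ≤ survival F w * Real.exp (-(c * (x - w))) := by
  obtain ⟨f, hf, hf0, hFf, hmono⟩ := hF
  have hi := integrable_density hf hFf hf0
  have hmem : ∀ t, 0 < survival F t → t ∈ {x | cdf (F : Measure ℝ) x < 1} := fun t ht => by
    rw [survival_eq_one_sub_cdf] at ht
    exact sub_pos.1 ht
  have hr : ∀ s t, 0 < survival F s → 0 < survival F t → s ≤ t →
      f s / survival F s ≤ f t / survival F t := fun s t hs ht hst => by
    have := hmono (hmem s hs) (hmem t ht) hst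
    simpa only [survival_eq_one_sub_cdf] using this
  have hanti := antitone_survival F
  have hc : 0 ≤ f w / survival F w := div_nonneg (hf0 w) hw.le
  -- The rate is the hazard rate at `w`. The density is hazard rate times survival, so on `[y, x]`
  -- it is at least `c * survival F x` to the right of `w` and at most `c * survival F y` to the
  -- left.
  refine ⟨f w / survival F w, le_mul_exp_of_increments (fun y x hwy hyx => ?_)
    (fun y x hyx hxw => ?_)⟩
  · rcases (survival_nonneg F x).eq_or_lt with h0 | h0
    · rw [← h0, mul_zero, sub_zero]
      exact survival_nonneg F y
    rw [survival_sub_survival hf hFf hf0]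
    have h1 : ∫ t in y..x, (f w / survival F w) * survival F x ≤ ∫ t in y..x, f t := by
      refine intervalIntegral.integral_mono_on hyx intervalIntegrable_const
        hi.intervalIntegrable fun t ht => ?_
      have hSt : survival F x ≤ survival F t := hanti ht.2
      have h2 := hr w t hw (h0.trans_le hSt) (hwy.trans ht.1)
      rw [le_div_iff₀ (h0.trans_le hSt)] at h2
      exact (mul_le_mul_of_nonneg_left hSt hc).trans h2
    rw [intervalIntegral.integral_const, smul_eq_mul] at h1
    linarith
  · rw [survival_sub_survival hf hFf hf0]
    have h1 : ∫ t in y..x, f t ≤ ∫ t in y..x, (f w / survival F w) * survival F y := by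
      refine intervalIntegral.integral_mono_on hyx hi.intervalIntegrable
        intervalIntegrable_const fun t ht => ?_
      have hSt : survival F t ≤ survival F y := hanti ht.1
      have hSw : 0 < survival F t := hw.trans_le (hanti (ht.2.trans hxw))
      have h2 := hr t w hSw hw (ht.2.trans hxw)
      rw [div_le_iff₀ hSw] at h2
      exact h2.trans (mul_le_mul_of_nonneg_left hSt hc)
    rw [intervalIntegral.integral_const, smul_eq_mul] at h1
    linarith

/-- The survival function of a law with monotone hazard rate is log-concave. -/
lemma Market.IsMHR.log_survival_concave {F : ProbabilityMeasure ℝ} (hF : Market.IsMHR F) {a b θ : ℝ}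
    (ha : 0 < survival F a) (hb : 0 < survival F b) (hθ : θ ∈ Icc (0 : ℝ) 1) :
    0 < survival F (a + θ * (b - a)) ∧
    (1 - θ) * Real.log (survival F a) + θ * Real.log (survival F b) ≤
      Real.log (survival F (a + θ * (b - a))) := by
  have hw : 0 < survival F (a + θ * (b - a)) := by
    rcases le_total a b with h | h
    · exact hb.trans_le (antitone_survival F (by nlinarith [hθ.1, hθ.2]))
    · exact ha.trans_le (antitone_survival F (by nlinarith [hθ.1, hθ.2]))
  refine ⟨hw, ?_⟩
  -- The exponential touching at the intermediate point is a supporting line for the logarithm;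
  -- averaged over `a` and `b`, its slope term cancels.
  obtain ⟨c, hc⟩ := hF.exists_survival_le_exp hw
  have key : ∀ x, 0 < survival F x → Real.log (survival F x) ≤
      Real.log (survival F (a + θ * (b - a))) - c * (x - (a + θ * (b - a))) := by
    intro x hx
    have := Real.log_le_log hx (hc x)
    rw [Real.log_mul hw.ne' (Real.exp_pos _).ne', Real.log_exp] at this
    linarith
  have h1 := mul_le_mul_of_nonneg_left (key a ha) (sub_nonneg.2 hθ.2)
  have h2 := mul_le_mul_of_nonneg_left (key b hb) hθ.1
  linarith

/-- The function `u ↦ log (1 - exp (-exp u))` is concave. -/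
lemma concaveOn_log_one_sub_exp_neg_exp :
    ConcaveOn ℝ univ fun u : ℝ => Real.log (1 - Real.exp (-Real.exp u)) := by
  have hpos : ∀ u : ℝ, 0 < 1 - Real.exp (-Real.exp u) := fun u => by
    have : Real.exp (-Real.exp u) < 1 := Real.exp_lt_one_iff.2 (by linarith [Real.exp_pos u])
    linarith
  have hd : ∀ u : ℝ, HasDerivAt (fun u : ℝ => Real.log (1 - Real.exp (-Real.exp u)))
      (Real.exp u / (Real.exp (Real.exp u) - 1)) u := by
    intro u
    have h1 : HasDerivAt (fun u : ℝ => 1 - Real.exp (-Real.exp u))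
        (Real.exp (-Real.exp u) * Real.exp u) u := by
      have := ((Real.hasDerivAt_exp u).neg.exp).const_sub 1
      exact this.congr_deriv (by rw [Pi.neg_apply]; ring)
    refine (h1.log (hpos u).ne').congr_deriv ?_
    have h2 : Real.exp (Real.exp u) - 1 ≠ 0 := by
      have := Real.one_lt_exp_iff.2 (Real.exp_pos u)
      linarith
    have h3 := (hpos u).ne'
    rw [div_eq_div_iff h3 h2]
    have h4 : Real.exp (-Real.exp u) * Real.exp (Real.exp u) = 1 := by
      rw [← Real.exp_add]; simp
    linear_combination Real.exp u * h4
  refine Antitone.concaveOn_univ_of_deriv (fun u => (hd u).differentiableAt) fun u v huv => ?_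
  rw [(hd u).deriv, (hd v).deriv]
  have hu := Real.exp_pos u
  have hv := Real.exp_pos v
  -- The derivative is the reciprocal of the slope of the secant of `exp` over `[0, exp u]`, and
  -- this slope increases with `u` by convexity.
  have h1 := convexOn_exp.secant_mono (mem_univ 0) (mem_univ (Real.exp u))
    (mem_univ (Real.exp v)) hu.ne' hv.ne' (Real.exp_le_exp.2 huv)
  simp only [Real.exp_zero, sub_zero] at h1
  have hu1 := Real.one_lt_exp_iff.2 hu
  have hv1 := Real.one_lt_exp_iff.2 hv
  rw [div_le_div_iff₀ hu hv] at h1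
  rw [div_le_div_iff₀ (by linarith) (by linarith)]
  linarith

end PostedPrice

/-! ### A fixed price that earns a fraction 1/e of the expected maximum. -/

namespace PostedPrice

/-- The probability that some valuation exceeds `t` when the number of agents has a Poisson
distribution with mean `D`. -/
def maxSurvival (D : ℝ) (F : ProbabilityMeasure ℝ) (t : ℝ) : ℝ :=
  1 - Real.exp (-(D * survival F t))

lemma maxSurvival_pos {D : ℝ} (hD : 0 < D) {F : ProbabilityMeasure ℝ} {t : ℝ}
    (ht : 0 < survival F t) : 0 < maxSurvival D F t := by
  have : Real.exp (-(D * survival F t)) < 1 := Real.exp_lt_one_iff.2 (by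
    have := mul_pos hD ht
    linarith)
  exact sub_pos.2 this

lemma maxSurvival_nonneg {D : ℝ} (hD : 0 ≤ D) (F : ProbabilityMeasure ℝ) (t : ℝ) :
    0 ≤ maxSurvival D F t := by
  have : Real.exp (-(D * survival F t)) ≤ 1 := Real.exp_le_one_iff.2 (by
    have := mul_nonneg hD (survival_nonneg F t)
    linarith)
  exact sub_nonneg.2 this

lemma maxSurvival_le_one (D : ℝ) (F : ProbabilityMeasure ℝ) (t : ℝ) : maxSurvival D F t ≤ 1 :=
  sub_le_self _ (Real.exp_pos _).le

lemma maxSurvival_eq_zero {D : ℝ} {F : ProbabilityMeasure ℝ} {t : ℝ} (ht : survival F t = 0) :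
    maxSurvival D F t = 0 := by
  simp [maxSurvival, ht]

/-- The function `u ↦ log (1 - exp (-exp u))` is increasing and concave, and it is applied to the
concave function `u = log D + log (survival F t)`. -/
lemma Market.IsMHR.log_maxSurvival_concave {F : ProbabilityMeasure ℝ} (hF : Market.IsMHR F)
    {D a b θ : ℝ} (hD : 0 < D) (ha : 0 < survival F a) (hb : 0 < survival F b)
    (hθ : θ ∈ Icc (0 : ℝ) 1) :
    (1 - θ) * Real.log (maxSurvival D F a) + θ * Real.log (maxSurvival D F b) ≤
      Real.log (maxSurvival D F (a + θ * (b - a))) := by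
  obtain ⟨hw, h1⟩ := hF.log_survival_concave ha hb hθ
  have hlog : ∀ t, 0 < survival F t →
      Real.exp (Real.log D + Real.log (survival F t)) = D * survival F t := fun t ht => by
    rw [Real.exp_add, Real.exp_log hD, Real.exp_log ht]
  have h2 := concaveOn_log_one_sub_exp_neg_exp.2
    (mem_univ (Real.log D + Real.log (survival F a)))
    (mem_univ (Real.log D + Real.log (survival F b))) (sub_nonneg.2 hθ.2) hθ.1
    (sub_add_cancel 1 θ)
  simp only [hlog a ha, hlog b hb, smul_eq_mul] at h2
  refine h2.trans (Real.log_le_log (sub_pos.2 (Real.exp_lt_one_iff.2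
    (by linarith [Real.exp_pos ((1 - θ) * (Real.log D + Real.log (survival F a)) +
      θ * (Real.log D + Real.log (survival F b)))]))) ?_)
  rw [maxSurvival, ← hlog _ hw]
  refine sub_le_sub_left (Real.exp_le_exp.2 (neg_le_neg (Real.exp_le_exp.2 ?_))) _
  linarith

open Filter Topology in
/-- The first-order condition for a price `v` that maximizes `w * maxSurvival D F w` locally in
the direction of `t`. -/
lemma Market.IsMHR.maxSurvival_le_exp {F : ProbabilityMeasure ℝ} (hF : Market.IsMHR F)
    {D v t : ℝ} (hD : 0 < D) (hv : 0 < v) (hSv : 0 < survival F v)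
    (hmax : ∀ᶠ θ in 𝓝[>] (0 : ℝ), (v + θ * (t - v)) * maxSurvival D F (v + θ * (t - v)) ≤
      v * maxSurvival D F v) :
    maxSurvival D F t ≤ maxSurvival D F v * Real.exp (1 - t / v) := by
  have hGv := maxSurvival_pos hD hSv
  rcases (survival_nonneg F t).eq_or_lt with h0 | h0
  · rw [maxSurvival_eq_zero h0.symm]
    exact (mul_pos hGv (Real.exp_pos _)).le
  have hGt := maxSurvival_pos hD h0
  suffices h : Real.log (maxSurvival D F t) - Real.log (maxSurvival D F v) ≤ 1 - t / v by
    have h1 := Real.exp_le_exp.2 h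
    rw [Real.exp_sub, Real.exp_log hGt, Real.exp_log hGv, div_le_iff₀ hGv] at h1
    linarith
  -- With `w = v + θ (t - v)` and G for `maxSurvival D F`, concavity and maximality give `θ (log
  -- G(t) - log G(v)) ≤ log G(w) - log G(v) ≤ log (v / w) ≤ v / w - 1`. Dividing by `θ` and letting
  -- `θ → 0` leaves `1 - t / v`.
  have hlim : Tendsto (fun θ : ℝ => -((t - v) / v) / (1 + θ * ((t - v) / v))) (𝓝[>] 0)
      (𝓝 (1 - t / v)) := by
    have h1 : ContinuousAt (fun θ : ℝ => -((t - v) / v) / (1 + θ * ((t - v) / v))) 0 := by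
      refine ContinuousAt.div (by fun_prop) (by fun_prop) (by simp)
    have h2 := h1.tendsto.mono_left (nhdsWithin_le_nhds (s := Ioi (0 : ℝ)))
    have h3 : -((t - v) / v) / (1 + 0 * ((t - v) / v)) = 1 - t / v := by
      rw [zero_mul, add_zero, div_one, sub_div, div_self hv.ne']; ring
    rwa [h3] at h2
  have hpos : ∀ᶠ θ in 𝓝[>] (0 : ℝ), 0 < 1 + θ * ((t - v) / v) := by
    have h1 : ContinuousAt (fun θ : ℝ => 1 + θ * ((t - v) / v)) 0 := by fun_prop
    exact (h1.tendsto.eventually (lt_mem_nhds (by simp))).filter_mono nhdsWithin_le_nhds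
  refine ge_of_tendsto hlim ?_
  filter_upwards [hmax, hpos, Ioc_mem_nhdsGT (zero_lt_one (α := ℝ))] with θ h1 h2 hθ
  have hw : v + θ * (t - v) = v * (1 + θ * ((t - v) / v)) := by field_simp
  have hwpos : 0 < v + θ * (t - v) := by rw [hw]; positivity
  have hSw := (hF.log_survival_concave hSv h0 ⟨hθ.1.le, hθ.2⟩).1
  have hGw := maxSurvival_pos hD hSw
  have h3 := hF.log_maxSurvival_concave hD hSv h0 ⟨hθ.1.le, hθ.2⟩
  have h4 := Real.log_le_log (mul_pos hwpos hGw) h1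
  rw [Real.log_mul hwpos.ne' hGw.ne', Real.log_mul hv.ne' hGv.ne', hw,
    Real.log_mul hv.ne' h2.ne', ← hw] at h4
  have h5 := Real.one_sub_inv_le_log_of_pos h2
  rw [le_div_iff₀ h2]
  have h6 : θ * (Real.log (maxSurvival D F t) - Real.log (maxSurvival D F v)) ≤
      (1 + θ * ((t - v) / v))⁻¹ - 1 := by linarith
  have h7 : (1 + θ * ((t - v) / v))⁻¹ - 1 = θ * (-((t - v) / v) / (1 + θ * ((t - v) / v))) := by
    field_simp
    ring
  rw [h7] at h6
  have h8 := le_of_mul_le_mul_left h6 hθ.1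
  rwa [le_div_iff₀ h2] at h8

lemma lintegral_exp_one_sub_div {G v : ℝ} (hG : 0 ≤ G) (hv : 0 < v) (a : ℝ) :
    ∫⁻ t in Ioi a, ENNReal.ofReal (G * Real.exp (1 - t / v)) =
      ENNReal.ofReal (G * (v * Real.exp (1 - a / v))) := by
  have hneg : -v⁻¹ < 0 := by have := inv_pos.2 hv; linarith
  have h1 : ∀ t : ℝ, G * Real.exp (1 - t / v) = G * Real.exp 1 * Real.exp (-v⁻¹ * t) := by
    intro t
    rw [mul_assoc, ← Real.exp_add]
    congr 2
    ring
  simp only [h1]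
  rw [← ofReal_integral_eq_lintegral_ofReal ((integrableOn_exp_mul_Ioi hneg a).const_mul _)
    (Filter.Eventually.of_forall fun t => by positivity), integral_const_mul,
    integral_exp_mul_Ioi hneg]
  congr 1
  rw [show 1 - a / v = 1 + -v⁻¹ * a by ring, Real.exp_add]
  field_simp

/-- Only `t < 1` is immediate from the support; continuity, that is, the absence of an atom, carries
the value to `1`. -/
lemma survival_one {F : ProbabilityMeasure ℝ} {h : ℝ} (hF : (F : Measure ℝ) (Icc 1 h) = 1)
    (hmhr : Market.IsMHR F) : survival F 1 = 1 := by
  have hlt : ∀ t < 1, survival F t = 1 := fun t ht => by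
    refine le_antisymm (survival_le_one F t) ?_
    have h1 : (F : Measure ℝ).real (Icc 1 h) = 1 := by rw [measureReal_def, hF]; rfl
    rw [← h1]
    exact measureReal_mono fun x hx => mem_Ioi.2 (ht.trans_le hx.1)
  have h1 : Filter.Tendsto (survival F) (nhdsWithin 1 (Iio 1)) (nhds (survival F 1)) :=
    hmhr.continuous_survival.continuousAt.tendsto.mono_left nhdsWithin_le_nhds
  refine tendsto_nhds_unique h1 ((tendsto_const_nhds (x := (1 : ℝ))).congr' ?_)
  filter_upwards [self_mem_nhdsWithin] with t ht
  exact (hlt t ht).symm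

lemma survival_eq_zero {F : ProbabilityMeasure ℝ} {h : ℝ} (hF : (F : Measure ℝ) (Icc 1 h) = 1)
    {t : ℝ} (ht : h ≤ t) : survival F t = 0 := by
  have h1 : (F : Measure ℝ) (Icc 1 h)ᶜ = 0 := (prob_compl_eq_zero_iff measurableSet_Icc).2 hF
  have h2 : (F : Measure ℝ) (Ioi t) = 0 :=
    measure_mono_null (fun x (hx : t < x) (hx' : x ∈ Icc 1 h) => (ht.trans_lt hx).not_ge hx'.2) h1
  rw [survival, measureReal_def, h2, ENNReal.toReal_zero]

/-- This is `3 ≤ e + 1/e`, the numerical margin in the case where the maximizing price lies on the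
boundary `D * survival F v = 1`. -/
lemma exp_one_add_one_mul_le : (1 : ℝ) + (1 - Real.exp (-1)) ≤ Real.exp 1 * (1 - Real.exp (-1)) := by
  have h1 := Real.exp_one_gt_d9
  have h2 : Real.exp 1 * Real.exp (-1) = 1 := by rw [← Real.exp_add]; simp
  have h3 : Real.exp (-1) ≥ 0 := (Real.exp_pos _).le
  nlinarith

open Filter Topology in
/-- For an MHR law, some price which at most one of the expected `D` agents can afford yields, as
a fixed price, at least the fraction `1 / e` of the expected maximal valuation. -/
theorem exists_price_lintegral_maxSurvival_le {F : ProbabilityMeasure ℝ} {h : ℝ}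
    (hF : (F : Measure ℝ) (Icc 1 h) = 1) (hmhr : Market.IsMHR F) (hh : 1 < h)
    {D : ℝ} (hD : 1 ≤ D) :
    ∃ v ∈ Icc 1 h, 0 < survival F v ∧ D * survival F v ≤ 1 ∧
      ∫⁻ t in Ioi (0 : ℝ), ENNReal.ofReal (maxSurvival D F t) ≤
        ENNReal.ofReal (Real.exp 1 * (v * maxSurvival D F v)) := by
  have hD0 : 0 < D := by linarith
  have hSc := hmhr.continuous_survival
  obtain ⟨v₁, hv₁, hSv₁⟩ : ∃ v ∈ Icc 1 h, D * survival F v = 1 := by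
    have h1 := intermediate_value_Icc' hh.le (f := fun v => D * survival F v)
      (continuous_const.mul hSc).continuousOn
    exact h1 ⟨by simp [survival_eq_zero hF le_rfl], by simpa [survival_one hF hmhr] using hD⟩
  have hG₁ : maxSurvival D F v₁ = 1 - Real.exp (-1) := by rw [maxSurvival, hSv₁]
  have hSpos₁ : 0 < survival F v₁ := by
    by_contra hcon
    have := mul_nonpos_of_nonneg_of_nonpos hD0.le (not_lt.1 hcon)
    linarith
  have hGc : Continuous fun v => v * maxSurvival D F v := by
    unfold maxSurvival
    fun_prop
  -- Maximizing only above `v₁` enforces `D * survival F v ≤ 1`; the price is that the optimum may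
  -- sit at `v₁`.
  obtain ⟨v, hv, hmax⟩ := isCompact_Icc.exists_isMaxOn ⟨v₁, left_mem_Icc.2 hv₁.2⟩
    hGc.continuousOn
  have hv1 : 1 ≤ v := hv₁.1.trans hv.1
  have hv0 : 0 < v := by linarith
  have hSv : 0 < survival F v := by
    by_contra hcon
    have h0 : survival F v = 0 := le_antisymm (not_lt.1 hcon) (survival_nonneg F v)
    have h1 := isMaxOn_iff.1 hmax v₁ (left_mem_Icc.2 hv₁.2)
    rw [maxSurvival_eq_zero h0, mul_zero] at h1
    have h2 := mul_pos (by linarith [hv₁.1] : 0 < v₁) (maxSurvival_pos hD0 hSpos₁)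
    linarith
  have hGv := maxSurvival_pos hD0 hSv
  refine ⟨v, ⟨hv1, hv.2⟩, hSv, ?_, ?_⟩
  · rw [← hSv₁]
    exact mul_le_mul_of_nonneg_left (antitone_survival F hv.1) hD0.le
  have htan_right : ∀ t, v ≤ t →
      maxSurvival D F t ≤ maxSurvival D F v * Real.exp (1 - t / v) := by
    intro t ht
    rcases le_or_gt h t with hht | hht
    · rw [maxSurvival_eq_zero (survival_eq_zero hF hht)]
      positivity
    refine hmhr.maxSurvival_le_exp hD0 hv0 hSv ?_
    filter_upwards [Ioc_mem_nhdsGT (zero_lt_one (α := ℝ))] with θ hθ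
    exact isMaxOn_iff.1 hmax _ ⟨by nlinarith [hθ.1, hv.1], by nlinarith [hθ.1, hθ.2]⟩
  -- At the boundary `v = v₁` the exponential bound is available only to the right of `v`. There it
  -- contributes `v (1 - 1/e)`, and the trivial bound `1` contributes `v` on the left.
  rcases hv.1.eq_or_lt with heq | hlt
  · have hsplit : Ioi (0 : ℝ) = Ioc 0 v ∪ Ioi v := (Ioc_union_Ioi_eq_Ioi hv0.le).symm
    rw [hsplit, lintegral_union measurableSet_Ioi (Ioc_disjoint_Ioi le_rfl)]
    have h1 : ∫⁻ t in Ioc 0 v, ENNReal.ofReal (maxSurvival D F t) ≤ ENNReal.ofReal v := by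
      calc _ ≤ ∫⁻ t in Ioc 0 v, 1 := by
            refine lintegral_mono fun t => ?_
            rw [← ENNReal.ofReal_one]
            exact ENNReal.ofReal_le_ofReal (maxSurvival_le_one D F t)
        _ = _ := by rw [setLIntegral_one, Real.volume_Ioc, sub_zero]
    have h2 : ∫⁻ t in Ioi v, ENNReal.ofReal (maxSurvival D F t) ≤
        ENNReal.ofReal (maxSurvival D F v * (v * Real.exp (1 - v / v))) := by
      rw [← lintegral_exp_one_sub_div hGv.le hv0]
      exact setLIntegral_mono' measurableSet_Ioi fun t ht =>
        ENNReal.ofReal_le_ofReal (htan_right t (le_of_lt ht))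
    refine (add_le_add h1 h2).trans ?_
    rw [← ENNReal.ofReal_add hv0.le (by positivity), div_self hv0.ne', sub_self, Real.exp_zero,
      ← heq, hG₁]
    refine ENNReal.ofReal_le_ofReal ?_
    have h3 := exp_one_add_one_mul_le
    have h4 := mul_le_mul_of_nonneg_left h3 (by linarith [hv₁.1] : 0 ≤ v₁)
    linarith
  -- When `v > v₁` small moves to the left remain admissible, so the exponential bound holds on both
  -- sides.
  · have htan_left : ∀ t, t ≤ v →
        maxSurvival D F t ≤ maxSurvival D F v * Real.exp (1 - t / v) := by
      intro t ht
      refine hmhr.maxSurvival_le_exp hD0 hv0 hSv ?_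
      have h1 : ContinuousAt (fun θ : ℝ => v + θ * (t - v)) 0 := by fun_prop
      have h2 : ∀ᶠ θ in 𝓝[>] (0 : ℝ), v₁ < v + θ * (t - v) :=
        (h1.tendsto.eventually (lt_mem_nhds (by simpa using hlt))).filter_mono nhdsWithin_le_nhds
      filter_upwards [h2, self_mem_nhdsWithin] with θ hθ hθ0
      have hθ0' : 0 < θ := hθ0
      exact isMaxOn_iff.1 hmax _ ⟨hθ.le, by nlinarith [hv.2]⟩
    calc _ ≤ ∫⁻ t in Ioi (0 : ℝ),
          ENNReal.ofReal (maxSurvival D F v * Real.exp (1 - t / v)) :=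
          lintegral_mono fun t => ENNReal.ofReal_le_ofReal
            ((le_total v t).elim (htan_right t) (htan_left t))
      _ = _ := by
          rw [lintegral_exp_one_sub_div hGv.le hv0]
          congr 1
          rw [zero_div, sub_zero]
          ring

/-- Moving the price towards `1` by the factor `1 - ε` compensates for a decrease of the expected
number of agents from `D` to `D ^ (1 - ε)`. -/
lemma Market.IsMHR.mul_maxSurvival_le {F : ProbabilityMeasure ℝ} (hmhr : Market.IsMHR F)
    (h1 : survival F 1 = 1) {D ε v : ℝ} (hD : 0 < D) (hε : ε ∈ Ioo (0 : ℝ) 1) (hv : 1 ≤ v)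
    (hSv : 0 < survival F v) (hDv : D * survival F v ≤ 1) :
    0 < survival F (1 + (1 - ε) * (v - 1)) ∧
    (1 - ε) * (v * maxSurvival D F v) ≤
      (1 + (1 - ε) * (v - 1)) * maxSurvival (D ^ (1 - ε)) F (1 + (1 - ε) * (v - 1)) := by
  obtain ⟨hS, hlog⟩ := hmhr.log_survival_concave (by rw [h1]; exact one_pos : 0 < survival F 1)
    hSv (θ := 1 - ε) ⟨by linarith [hε.2], by linarith [hε.1]⟩
  refine ⟨hS, ?_⟩
  rw [h1, Real.log_one, mul_zero, zero_add] at hlog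
  have hDp : 0 < D ^ (1 - ε) := Real.rpow_pos_of_pos hD _
  -- In logarithms: concavity between `1` and `v` bounds the right side below by `(1 - ε) log (D *
  -- survival F v)`, and this logarithm is not positive.
  have hle : D * survival F v ≤ D ^ (1 - ε) * survival F (1 + (1 - ε) * (v - 1)) := by
    rw [← Real.log_le_log_iff (mul_pos hD hSv) (mul_pos hDp hS), Real.log_mul hDp.ne' hS.ne',
      Real.log_rpow hD]
    have h2 := Real.log_nonpos (mul_pos hD hSv).le hDv
    have h3 := Real.log_mul hD.ne' hSv.ne'
    nlinarith [hε.1]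
  have hG : maxSurvival D F v ≤ maxSurvival (D ^ (1 - ε)) F (1 + (1 - ε) * (v - 1)) :=
    sub_le_sub_left (Real.exp_le_exp.2 (neg_le_neg hle)) _
  rw [← mul_assoc]
  exact mul_le_mul (by linarith [hε.1]) hG (maxSurvival_nonneg hD.le F v)
    (by nlinarith [hε.2])

end PostedPrice

/-! ### The mechanism `M_C` and the comparison with the benchmark. -/

namespace PostedPrice
namespace Market

variable (M : Market)

lemma isSwitchTime_switchTime : M.IsSwitchTime M.switchTime :=
  M.existsUnique_switchTime.choose_spec.1

lemma switchTime_lt : M.switchTime < M.T := M.isSwitchTime_switchTime.1.2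

lemma tailRevenue_switchTime : M.tailRevenue M.switchTime = M.kConst :=
  M.isSwitchTime_switchTime.2

lemma continuous_tail_integrand :
    Continuous fun s : ℝ => M.xiExt s * (M.lam * Real.exp (-(M.lam * s))) := by
  have := M.continuous_xiExt
  fun_prop

/-- At time `0` the slope constant vanishes, whereas the tail revenue is positive. -/
lemma switchTime_pos : 0 < M.switchTime := by
  refine lt_of_le_of_ne M.isSwitchTime_switchTime.1.1 fun h => ?_
  have h1 := M.isSwitchTime_switchTime.2
  rw [← h, M.tailRevenue_eq ⟨le_rfl, M.T_pos.le⟩] at h1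
  have h2 : 0 < ∫ s in (0 : ℝ)..M.T, M.xiExt s * (M.lam * Real.exp (-(M.lam * s))) := by
    have hl := M.lam_pos
    refine intervalIntegral.integral_pos M.T_pos M.continuous_tail_integrand.continuousOn
      (fun s _ => mul_nonneg (M.xiExt_nonneg s) (by positivity)) ⟨0, ⟨le_rfl, M.T_pos.le⟩, ?_⟩
    rw [M.xiExt_zero]
    positivity
  simp only [mul_zero, Real.exp_zero, one_mul, slopeConst, intervalIntegral.integral_same,
    zero_div] at h1
  exact h2.ne' h1

lemma switchTime_mem : M.switchTime ∈ Icc 0 M.T := ⟨M.switchTime_pos.le, M.switchTime_lt.le⟩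

lemma slope_denom_pos : 0 < M.lam * M.switchTime + Real.log M.h :=
  add_pos (mul_pos M.lam_pos M.switchTime_pos) M.log_h_pos

lemma kConst_eq : M.kConst = (M.lam * ∫ s in (0 : ℝ)..M.switchTime, M.xiExt s) /
    (M.lam * M.switchTime + Real.log M.h) := by
  rw [kConst, slopeConst, M.integral_xi_eq M.switchTime_mem]

lemma kConst_pos : 0 < M.kConst := by
  rw [kConst_eq]
  exact div_pos (mul_pos M.lam_pos (M.integral_xiExt_pos M.switchTime_pos)) M.slope_denom_pos

/-- The expected revenue from the minimum price after `t₀` is at most the discount at `t₀`. -/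
lemma kConst_le_xiExt : M.kConst ≤ M.xiExt M.switchTime := by
  have hl := M.lam_pos
  rw [← tailRevenue_switchTime, M.tailRevenue_eq M.switchTime_mem]
  set c := M.switchTime
  have hd : ∀ s : ℝ, HasDerivAt (fun u : ℝ => -Real.exp (-(M.lam * u)))
      (M.lam * Real.exp (-(M.lam * s))) s := by
    intro s
    refine (((hasDerivAt_id s).const_mul M.lam).neg.exp).neg.congr_deriv ?_
    simp; ring
  have hi := intervalIntegral.integral_eq_sub_of_hasDerivAt (a := c) (b := M.T)
    (fun s _ => hd s) (Continuous.intervalIntegrable (by fun_prop) _ _)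
  have hle : ∫ s in c..M.T, M.xiExt s * (M.lam * Real.exp (-(M.lam * s))) ≤
      ∫ s in c..M.T, M.xiExt c * (M.lam * Real.exp (-(M.lam * s))) := by
    refine intervalIntegral.integral_mono_on M.switchTime_lt.le
      (M.continuous_tail_integrand.intervalIntegrable _ _)
      (Continuous.intervalIntegrable (by fun_prop) _ _) fun s hs => ?_
    exact mul_le_mul_of_nonneg_right (M.antitone_xiExt hs.1) (by positivity)
  rw [intervalIntegral.integral_const_mul, hi] at hle
  have h1 := mul_le_mul_of_nonneg_left hle (Real.exp_pos (M.lam * c)).le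
  refine h1.trans ?_
  have h5 : Real.exp (M.lam * c) * Real.exp (-(M.lam * c)) = 1 := by
    rw [← Real.exp_add]; simp
  have h6 : 0 ≤ M.xiExt c * (Real.exp (M.lam * c) * Real.exp (-(M.lam * M.T))) :=
    mul_nonneg (M.xiExt_nonneg c) (by positivity)
  linear_combination h6 + M.xiExt c * h5

/-- The valuation above which agents arriving at time `t` accept the price of `M_C`. -/
def acceptThreshold (t : ℝ) : ℝ :=
  M.h * Real.exp (M.lam * min t M.switchTime -
    M.lam / M.kConst * ∫ s in (0 : ℝ)..min t M.switchTime, M.xiExt s)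

lemma continuous_acceptThreshold : Continuous M.acceptThreshold := by
  have h1 : Continuous fun u : ℝ => ∫ s in (0 : ℝ)..u, M.xiExt s :=
    intervalIntegral.continuous_primitive
      (fun a b => M.continuous_xiExt.intervalIntegrable a b) 0
  have h2 : Continuous fun t : ℝ => ∫ s in (0 : ℝ)..min t M.switchTime, M.xiExt s :=
    h1.comp (by fun_prop)
  unfold acceptThreshold
  fun_prop

lemma acceptThreshold_pos (t : ℝ) : 0 < M.acceptThreshold t :=
  mul_pos (by linarith [M.one_lt_h]) (Real.exp_pos _)

/-- Before `t₀` the logarithmic derivative is `lam (1 - xi / k)`, which is not positive because `k ≤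
xi t₀ ≤ xi t`; afterwards the threshold is constant. -/
lemma antitone_acceptThreshold : Antitone M.acceptThreshold := by
  intro a b hab
  have hk := M.kConst_pos
  have hl := M.lam_pos
  refine mul_le_mul_of_nonneg_left (Real.exp_le_exp.2 ?_) (by linarith [M.one_lt_h])
  set a' := min a M.switchTime
  set b' := min b M.switchTime
  have hab' : a' ≤ b' := min_le_min hab le_rfl
  have h1 : ∫ s in a'..b', M.kConst ≤ ∫ s in a'..b', M.xiExt s := by
    refine intervalIntegral.integral_mono_on hab' intervalIntegrable_const
      (M.continuous_xiExt.intervalIntegrable _ _) fun s hs => ?_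
    exact M.kConst_le_xiExt.trans (M.antitone_xiExt (hs.2.trans (min_le_right _ _)))
  rw [intervalIntegral.integral_const, smul_eq_mul] at h1
  have h2 := intervalIntegral.integral_add_adjacent_intervals (μ := volume)
    (M.continuous_xiExt.intervalIntegrable 0 a') (M.continuous_xiExt.intervalIntegrable a' b')
  rw [← h2]
  have h3 := mul_le_mul_of_nonneg_left h1 (div_pos hl hk).le
  have h4 : M.lam / M.kConst * ((b' - a') * M.kConst) = M.lam * (b' - a') := by field_simp
  rw [h4] at h3
  linarith

lemma acceptThreshold_zero : M.acceptThreshold 0 = M.h := by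
  simp [acceptThreshold, min_eq_left M.switchTime_pos.le]

/-- The value of `k` makes the exponent at `t₀` equal to `-log h`. -/
lemma acceptThreshold_of_le {t : ℝ} (ht : M.switchTime ≤ t) : M.acceptThreshold t = 1 := by
  have h1 : M.lam / M.kConst * ∫ s in (0 : ℝ)..M.switchTime, M.xiExt s =
      M.lam * M.switchTime + Real.log M.h := by
    have h2 := (M.integral_xiExt_pos M.switchTime_pos).ne'
    have h3 := M.slope_denom_pos.ne'
    have h4 := M.lam_pos.ne'
    rw [kConst_eq]
    field_simp
  have hh : 0 < M.h := by linarith [M.one_lt_h]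
  rw [acceptThreshold, min_eq_right ht, h1, sub_add_cancel_left, Real.exp_neg, Real.exp_log hh,
    mul_inv_cancel₀ hh.ne']

lemma priceC_eq {t : ℝ} (ht : 0 ≤ t) : M.priceC t = M.acceptThreshold t * M.xi t := by
  unfold priceC
  split_ifs with h
  · rw [acceptThreshold, min_eq_left h.le, M.integral_xi_eq ⟨ht, h.le.trans M.switchTime_lt.le⟩]
    ring
  · rw [M.acceptThreshold_of_le (not_lt.1 h), one_mul]

lemma priceC_anti {a b : ℝ} (ha : 0 ≤ a) (hab : a ≤ b) (hb : b ≤ M.T) :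
    M.priceC b ≤ M.priceC a := by
  rw [M.priceC_eq ha, M.priceC_eq (ha.trans hab)]
  exact mul_le_mul (M.antitone_acceptThreshold hab)
    (M.xi_antitoneOn ⟨ha, hab.trans hb⟩ ⟨ha.trans hab, hb⟩ hab) (M.xi_nonneg (ha.trans hab))
    (M.acceptThreshold_pos a).le

lemma exists_acceptThreshold_eq {v : ℝ} (hv : v ∈ Icc 1 M.h) :
    ∃ s ∈ Icc 0 M.switchTime, M.acceptThreshold s = v := by
  have h1 := intermediate_value_Icc' M.switchTime_pos.le
    M.continuous_acceptThreshold.continuousOn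
  rw [M.acceptThreshold_zero, M.acceptThreshold_of_le le_rfl] at h1
  exact h1 hv

/-- The expected revenue of `M_C` for an MHR law against the maximal ratio between its prices at
the endpoints of an interval of length `τ` that starts before the switch time. -/
theorem le_expectedRevenue_priceC {F : ProbabilityMeasure ℝ} {τ v : ℝ} (hτ : 0 ≤ τ)
    (hT : M.switchTime + τ ≤ M.T) (hxi : 0 < M.xi (M.switchTime + τ)) (hv : v ∈ Icc 1 M.h)
    (hS : 0 < survival F v) (hlτ : 0 < M.lam * τ) :
    M.expectedRevenue F M.priceC ≠ 0 ∧
    ENNReal.ofReal (M.xi (M.switchTime + τ) * (v * maxSurvival (M.lam * τ) F v)) ≤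
      M.maxPriceRatioUpTo M.switchTime τ * M.expectedRevenue F M.priceC := by
  obtain ⟨s, hs, hsv⟩ := M.exists_acceptThreshold_eq hv
  have hsT : s + τ ≤ M.T := by linarith [hs.2]
  have hsτ0 : 0 ≤ s + τ := by linarith [hs.1]
  have hxi' : M.xi (M.switchTime + τ) ≤ M.xi (s + τ) :=
    M.xi_antitoneOn ⟨hsτ0, hsT⟩ ⟨by linarith [hs.1, hs.2], hT⟩ (by linarith [hs.2])
  -- A positive discount at `t₀ + τ` keeps the denominator of the price ratio positive, so the
  -- conventions for division by zero play no role.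
  have hc : 0 < M.priceC (s + τ) := by
    rw [M.priceC_eq hsτ0]
    exact mul_pos (M.acceptThreshold_pos _) (hxi.trans_le hxi')
  have hG := maxSurvival_pos hlτ hS
  have hrev : ENNReal.ofReal (M.priceC (s + τ)) *
      ENNReal.ofReal (maxSurvival (M.lam * τ) F v) ≤ M.expectedRevenue F M.priceC := by
    refine M.le_expectedRevenue F hs.1 hτ hsT (fun t ht => ?_) fun t ht =>
      M.priceC_anti ht.1 ht.2.le hsT
    rw [M.priceC_eq (hs.1.trans ht.1), ← hsv]
    exact mul_le_mul_of_nonneg_right (M.antitone_acceptThreshold ht.1)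
      (M.xi_nonneg (hs.1.trans ht.1))
  refine ⟨fun h0 => ?_, ?_⟩
  · rw [h0, nonpos_iff_eq_zero, mul_eq_zero, ENNReal.ofReal_eq_zero, ENNReal.ofReal_eq_zero]
      at hrev
    rcases hrev with h | h <;> linarith
  have hratio : ENNReal.ofReal (M.priceC s) ≤
      M.maxPriceRatioUpTo M.switchTime τ * ENNReal.ofReal (M.priceC (s + τ)) := by
    rw [← ENNReal.div_le_iff (ENNReal.ofReal_pos.2 hc).ne' ENNReal.ofReal_ne_top]
    exact le_iSup₂ (f := fun s (_ : s ∈ Icc 0 M.switchTime) => M.priceRatio τ s) s hs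
  have hps : M.xi (M.switchTime + τ) * v ≤ M.priceC s := by
    rw [M.priceC_eq hs.1, hsv, mul_comm]
    refine mul_le_mul_of_nonneg_left (hxi'.trans ?_) (by linarith [hv.1])
    exact M.xi_antitoneOn ⟨hs.1, by linarith⟩ ⟨hsτ0, hsT⟩ (by linarith)
  calc _ = ENNReal.ofReal (M.xi (M.switchTime + τ) * v) *
        ENNReal.ofReal (maxSurvival (M.lam * τ) F v) := by
        rw [← ENNReal.ofReal_mul' hG.le, mul_assoc]
    _ ≤ (M.maxPriceRatioUpTo M.switchTime τ * ENNReal.ofReal (M.priceC (s + τ))) *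
        ENNReal.ofReal (maxSurvival (M.lam * τ) F v) :=
        mul_le_mul_left ((ENNReal.ofReal_le_ofReal hps).trans hratio) _
    _ ≤ _ := by
        rw [mul_assoc]
        exact mul_le_mul_right hrev _

/-- For an MHR law every posted-price mechanism earns at most `e` times what a suitable fixed
price earns from the fewer agents that arrive in a period of length `τ`. -/
theorem exists_price_benchmark_le {F : ProbabilityMeasure ℝ} (hF : F ∈ M.mhrLaws) {τ ε : ℝ}
    (hτ : τ ∈ Ioc 0 M.T) (hε : ε ∈ Ioo (0 : ℝ) 1)
    (hpow : M.lam * τ = (M.lam * M.T) ^ (1 - ε)) :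
    ∃ v ∈ Icc 1 M.h, 0 < survival F v ∧ ENNReal.ofReal (1 - ε) * M.benchmark F ≤
      ENNReal.ofReal (Real.exp 1 * (v * maxSurvival (M.lam * τ) F v)) := by
  have hl := M.lam_pos
  have hD0 : 0 < M.lam * M.T := mul_pos hl M.T_pos
  -- If `lam * T < 1`, the power `1 - ε < 1` would increase it, contradicting `τ ≤ T`.
  have hD : 1 ≤ M.lam * M.T := by
    by_contra hcon
    have h1 := Real.rpow_lt_rpow_of_exponent_gt hD0 (not_le.1 hcon)
      (by linarith [hε.1] : 1 - ε < 1)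
    rw [Real.rpow_one, ← hpow] at h1
    have := mul_le_mul_of_nonneg_left hτ.2 hl.le
    linarith
  obtain ⟨v, hv, hSv, hDv, hle⟩ :=
    exists_price_lintegral_maxSurvival_le hF.1 hF.2 M.one_lt_h hD
  obtain ⟨hS, hprice⟩ := hF.2.mul_maxSurvival_le (survival_one hF.1 hF.2) hD0 hε hv.1 hSv hDv
  rw [← hpow] at hprice
  refine ⟨1 + (1 - ε) * (v - 1), ⟨?_, ?_⟩, hS, ?_⟩
  · nlinarith [hε.2, hv.1]
  · nlinarith [hε.1, hv.1, hv.2]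
  have hb : M.benchmark F ≤
      ENNReal.ofReal (Real.exp 1 * (v * maxSurvival (M.lam * M.T) F v)) :=
    iSup₂_le fun p _ => (M.expectedRevenue_le F p).trans hle
  refine (mul_le_mul_right hb _).trans ?_
  rw [← ENNReal.ofReal_mul (by linarith [hε.2])]
  refine ENNReal.ofReal_le_ofReal ?_
  have := mul_le_mul_of_nonneg_left hprice (Real.exp_pos 1).le
  linarith

/-- Identifies the argument of the discount in `ratioBound` as `t₀ + τ`. -/
lemma rpow_mul_rpow_eq {τ ε : ℝ} (hpow : M.lam * τ = (M.lam * M.T) ^ (1 - ε)) :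
    M.T ^ (1 - ε) * M.lam ^ (-ε) = τ := by
  have hl := M.lam_pos
  rw [Real.mul_rpow hl.le M.T_pos.le, sub_eq_add_neg, Real.rpow_add hl, Real.rpow_one] at hpow
  rw [sub_eq_add_neg]
  apply mul_left_cancel₀ hl.ne'
  rw [hpow]
  ring

lemma maxPriceRatioUpTo_mono {b b' : ℝ} (hb : b ≤ b') (τ : ℝ) :
    M.maxPriceRatioUpTo b τ ≤ M.maxPriceRatioUpTo b' τ :=
  biSup_mono fun _ hs => ⟨hs.1, hs.2.trans hb⟩

lemma ratioBound_anti (ε : ℝ) {κ κ' : ℝ≥0∞} (h : κ ≤ κ') :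
    M.ratioBound ε κ' ≤ M.ratioBound ε κ :=
  ENNReal.div_le_div_left (mul_le_mul_left h _) _

/-- The fixed-price revenue `v * maxSurvival (lam * τ) F v` links the two sides: times `e` it
dominates `(1 - ε)` times the benchmark, and times `xi (t₀ + τ)` it is dominated by `κ` times the
revenue of `M_C`. -/
theorem ratioBound_le_competitiveRatio {τ ε : ℝ} (hτ : τ ∈ Ioc 0 M.T)
    (hε : ε ∈ Ioo (0 : ℝ) 1) (hpow : M.lam * τ = (M.lam * M.T) ^ (1 - ε)) :
    M.ratioBound ε (M.maxPriceRatioUpTo (min M.switchTime (M.T - τ)) τ) ≤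
      M.competitiveRatio M.mhrLaws M.priceC := by
  rw [ratioBound, M.rpow_mul_rpow_eq hpow]
  have ht0 := M.switchTime_pos
  -- A zero discount at `t₀ + τ` makes the bound trivial; otherwise `t₀ + τ < T`, and the minimum
  -- `b` equals `t₀`.
  rcases (M.xi_nonneg (by linarith [hτ.1] : 0 ≤ M.switchTime + τ)).eq_or_lt with hx | hx
  · rw [← hx, zero_mul, ENNReal.ofReal_zero, ENNReal.zero_div]
    exact zero_le
  have hT : M.switchTime + τ < M.T := by
    by_contra hcon
    rw [M.xi_eq_zero _ (not_lt.1 hcon)] at hx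
    exact lt_irrefl _ hx
  rw [min_eq_left (by linarith)]
  refine le_iInf₂ fun F hF => ?_
  obtain ⟨v, hv, hS, hbench⟩ := M.exists_price_benchmark_le hF hτ hε hpow
  obtain ⟨hne, hrev⟩ := M.le_expectedRevenue_priceC hτ.1.le hT.le hx hv hS
    (mul_pos M.lam_pos hτ.1)
  have h1ε : 0 < 1 - ε := by linarith [hε.2]
  have hbtop : M.benchmark F ≠ ∞ := fun h => by
    rw [h, ENNReal.mul_top (ENNReal.ofReal_pos.2 h1ε).ne', top_le_iff] at hbench
    exact ENNReal.ofReal_ne_top hbench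
  -- Non-zero revenue and a finite benchmark exclude the forms `0 / 0` and `∞ / ∞`.
  rw [ENNReal.le_div_iff_mul_le (Or.inr hne) (Or.inl hbtop), div_eq_mul_inv, mul_right_comm,
    ← div_eq_mul_inv]
  refine ENNReal.div_le_of_le_mul ?_
  calc ENNReal.ofReal (M.xi (M.switchTime + τ) * (1 - ε)) * M.benchmark F
      = ENNReal.ofReal (M.xi (M.switchTime + τ)) *
        (ENNReal.ofReal (1 - ε) * M.benchmark F) := by
        rw [ENNReal.ofReal_mul hx.le, mul_assoc]
    _ ≤ ENNReal.ofReal (M.xi (M.switchTime + τ)) *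
        ENNReal.ofReal (Real.exp 1 * (v * maxSurvival (M.lam * τ) F v)) :=
        mul_le_mul_right hbench _
    _ = ENNReal.ofReal (M.xi (M.switchTime + τ) * (v * maxSurvival (M.lam * τ) F v)) *
        ENNReal.ofReal (Real.exp 1) := by
        rw [← ENNReal.ofReal_mul hx.le, ← ENNReal.ofReal_mul' (Real.exp_pos 1).le]
        congr 1
        ring
    _ ≤ (M.maxPriceRatioUpTo M.switchTime τ * M.expectedRevenue F M.priceC) *
        ENNReal.ofReal (Real.exp 1) := mul_le_mul_left hrev _
    _ = _ := by ring

end Market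
end PostedPrice
end

theorem theorem3 (M : PostedPrice.Market) (τ ε : ℝ)
    (hτ : τ ∈ Set.Ioc 0 M.T) (hε : ε ∈ Set.Ioo (0 : ℝ) 1)
    (hpow : M.lam * τ = (M.lam * M.T) ^ (1 - ε))
    (hlow : 1 - Real.log (Real.exp 1 - 1) ≤ M.lam * τ) :
    -- the bound with the maximal price ratio over all intervals of length `τ` in `[0, T]`
    M.ratioBound ε (M.maxPriceRatio τ) ≤ M.competitiveRatio M.mhrLaws M.priceC ∧
    -- the bound with the maximal price ratio over those intervals that start at or before `t₀`
    M.ratioBound ε (M.maxPriceRatioUpTo (min M.switchTime (M.T - τ)) τ) ≤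
      M.competitiveRatio M.mhrLaws M.priceC := by
  have h := M.ratioBound_le_competitiveRatio hτ hε hpow
  exact ⟨(M.ratioBound_anti ε (M.maxPriceRatioUpTo_mono (min_le_right _ _) τ)).trans h, h⟩
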